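/- Let $S$ be a finite nonempty set and let $\mathcal C=(S,\Delta,r)$ be a semimatroid: $\Delta$ is a non-void simplicial complex over $S$ (a family of subsets of $S$, called faces, closed under taking subsets; not every element of $S$ has to be a vertex) and $r:\Delta\to\mathbb N$ satisfies, for all $\sigma,\tau\in\Delta$: $r(\sigma)\le|\sigma|$; $r(\sigma)\le r(\tau)$ if $\sigma\subseteq\tau$; $r(\sigma)+r(\tau)\ge r(\sigma\cup\tau)+r(\sigma\cap\tau)$ if $\sigma\cup\tau\in\Delta$; $\sigma\cup\tau\in\Delta$ if $r(\sigma)=r(\sigma\cap\tau)$; and if $r(\sigma)<r(\tau)$, then $\sigma\cup\{y\}\in\Delta$ for some $y\in\tau\setminus\sigma$. A face $\sigma$ is independent if $r(\sigma)=|\sigma|$; let $r_{\mathcal C}$ be the common cardinality of the maximal independent faces, and let $$T_{\mathcal C}(x,y)=\sum_{\sigma\in\Delta}(x-1)^{r_{\mathcal C}-r(\sigma)}(y-1)^{|\sigma|-r(\sigma)}$$ be the Tutte polynomial. Let $P$ be a poset. A function $f:\Delta\to P$ is monotone if $f(\sigma)\le f(\tau)$ for all faces $\sigma\subseteq\tau$;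 put $\Delta_{\le p}=\{\sigma\in\Delta: f(\sigma)\le p\}$ and $\Delta_{<p}=\{\sigma\in\Delta: f(\sigma)<p\}$. A decision tree for $f$ is a binary tree defined recursively: it is a single leaf labeled $p$ if $\Delta$ consists of all subsets of $S$ and $f$ is constant with value $p$; or its root is labeled by some $x\in S$, one subtree is a decision tree for the deletion $f_{\setminus x}$ (the restriction of $f$ to $\{\tau\in\Delta:x\notin\tau\}$, over $S\setminus\{x\}$), and the other is a decision tree for the link $f_{/x}$ (the function $\tau\mapsto f(\tau\cup\{x\})$ on $\{\tau: x\notin\tau,\ \tau\cup\{x\}\in\Delta\}$, over $S\setminus\{x\}$) if $\{x\}\in\Delta$, and a leaf labeled $N$ if $\{x\}\notin\Delta$. The tree is run on a set $\sigma$ by asking at each interior vertex whether its label lies in $\sigma$ and moving to the link subtree if so, to the deletion subtree otherwise. A face $\sigma$ is $p$-evasive if $f(\sigma)=p$ and the tree makes $|S|$ queries on $\sigma$. Fix a field $k$, and let $\widetilde\beta_d$ denote reduced (relative) Betti numbers over $k$, the empty face having dimension $-1$. A decision tree for a monotone $f$ is optimal if for all $p\in P$ and $i\ge 0$ the number of $p$-evasive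 faces of cardinality $i$ is $\widetilde\beta_{i-1}(\Delta_{\le p},\Delta_{<p})$; a monotone $f$ is homology decidable if it has an optimal decision tree, and $\Delta$ is semi-nonevasive if a constant function on $\Delta$ is homology decidable. For $f:\Delta\to\mathbb N$ monotone, the Poincaré polynomials are $$P(f;q,x)=\sum_{i,j\ge0}\widetilde\beta_{i-1}(\Delta_{\le j},\Delta_{<j})\,q^i x^j,\qquad P(\Delta;q)=\sum_{i\ge0}\widetilde\beta_{i-1}(\Delta)\,q^i.$$ Then: 1. The rank function $r$ is homology decidable, and $P(r;q,x)=(qx)^{r_{\mathcal C}}\,T_{\mathcal C}\!\left(\frac{qx+1}{qx},0\right)$. 2. The nullity function $n(\sigma)=|\sigma|-r(\sigma)$ on $\Delta$ is monotone and homology decidable, and $P(n;q,x)=q^{r_{\mathcal C}}\,T_{\mathcal C}(0,qx+1)$. 3. $\Delta$ is semi-nonevasive, and $P(\Delta;q)=T_{\mathcal C}(0,0)\,q^{r_{\mathcal C}}$. -/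

import Mathlib

/-- An abstract simplicial complex over a finite ground set: a family of subsets (faces) of the
ground set that is closed under taking subsets. The family may be void, may consist of the empty
face only, and not every element of the ground set has to be a vertex. -/
structure FinComplex (α : Type*) where
  /-- the ground set -/
  ground : Finset α
  /-- the faces -/
  faces : Finset (Finset α)
  subset_ground : ∀ σ ∈ faces, σ ⊆ ground
  down_closed : ∀ σ ∈ faces, ∀ τ, τ ⊆ σ → τ ∈ faces

namespace FinComplex

variable {α : Type*} [DecidableEq α]

/-- The deletion of `x`: the faces that do not contain `x`, over the ground set without `x`. -/
def deletion (Δ : FinComplex α) (x : α) : FinComplex α where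
  ground := Δ.ground.erase x
  faces := Δ.faces.filter (fun σ => x ∉ σ)
  subset_ground := fun σ hσ => by
    rw [Finset.mem_filter] at hσ
    exact Finset.subset_erase.2 ⟨Δ.subset_ground σ hσ.1, hσ.2⟩
  down_closed := fun σ hσ τ h => by
    rw [Finset.mem_filter] at hσ ⊢
    exact ⟨Δ.down_closed σ hσ.1 τ h, fun hx => hσ.2 (h hx)⟩

/-- The link of `x`: the faces `τ` with `x ∉ τ` and `τ ∪ {x}` a face, over the ground set
without `x`. (Every such `τ` is a face.) -/
def link (Δ : FinComplex α) (x : α) : FinComplex α where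
  ground := Δ.ground.erase x
  faces := Δ.faces.filter (fun τ => x ∉ τ ∧ insert x τ ∈ Δ.faces)
  subset_ground := fun σ hσ => by
    rw [Finset.mem_filter] at hσ
    exact Finset.subset_erase.2 ⟨Δ.subset_ground σ hσ.1, hσ.2.1⟩
  down_closed := fun σ hσ τ h => by
    rw [Finset.mem_filter] at hσ ⊢
    exact ⟨Δ.down_closed σ hσ.1 τ h, fun hx => hσ.2.1 (h hx),
      Δ.down_closed _ hσ.2.2 _ (Finset.insert_subset_insert x h)⟩

/-- A function `f : Δ → P` is given by a function on all finite sets of which only the values on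
faces matter; it is monotone if `f σ ≤ f τ` for all faces `σ ⊆ τ`. -/
def MonotoneFun {P : Type*} [PartialOrder P] (Δ : FinComplex α) (f : Finset α → P) : Prop :=
  ∀ σ ∈ Δ.faces, ∀ τ ∈ Δ.faces, σ ⊆ τ → f σ ≤ f τ

/-- The subcomplex `Δ_{≤ p}` of the faces on which `f` is at most `p`. -/
def sublevel {P : Type*} [PartialOrder P] (Δ : FinComplex α) (f : Finset α → P) (p : P) :
    Set (Finset α) :=
  {σ | σ ∈ Δ.faces ∧ f σ ≤ p}

/-- The subcomplex `Δ_{< p}` of the faces on which `f` is less than `p`. -/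
def strictSublevel {P : Type*} [PartialOrder P] (Δ : FinComplex α) (f : Finset α → P) (p : P) :
    Set (Finset α) :=
  {σ | σ ∈ Δ.faces ∧ f σ < p}

end FinComplex

section Homology

variable {α : Type*} [LinearOrder α] (k : Type*) [Field k]

/-- The simplicial boundary map with respect to the orientations induced by the linear order:
`∂ σ = ∑_{x ∈ σ} (-1)^{#{y ∈ σ : y < x}} (σ \ {x})`. It is augmented: the boundary of a vertex is
the empty face. -/
noncomputable def simplicialBoundary : (Finset α →₀ k) →ₗ[k] (Finset α →₀ k) :=
  Finsupp.linearCombination k (fun σ : Finset α =>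
    ∑ x ∈ σ, Finsupp.single (σ.erase x) ((-1 : k) ^ (σ.filter (fun y => y < x)).card))

/-- The augmented simplicial `d`-chains of a family `K` of faces: combinations of the faces of
dimension `d`, that is, of cardinality `d + 1`. The empty face has dimension `-1`. -/
noncomputable def simplicialChains (K : Set (Finset α)) (d : ℤ) : Submodule k (Finset α →₀ k) :=
  Finsupp.supported k k {σ | σ ∈ K ∧ (σ.card : ℤ) = d + 1}

/-- Relative `d`-cycles of the pair `(K, L)`. -/
noncomputable def relCycles (K L : Set (Finset α)) (d : ℤ) : Submodule k (Finset α →₀ k) :=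
  simplicialChains k K d ⊓ (simplicialChains k L (d - 1)).comap (simplicialBoundary k)

/-- Relative `d`-boundaries of the pair `(K, L)`. -/
noncomputable def relBoundaries (K L : Set (Finset α)) (d : ℤ) : Submodule k (Finset α →₀ k) :=
  (simplicialChains k K (d + 1)).map (simplicialBoundary k) ⊔ simplicialChains k L d

/-- The dimension of the quotient of a subspace `Z` by a subspace `B` (by `B ∩ Z` if `B` is not
contained in `Z`). -/
noncomputable def quotientDim {V : Type*} [AddCommGroup V] [Module k V] (Z B : Submodule k V) : ℕ :=
  Module.finrank k (↥Z ⧸ B.submoduleOf Z)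

/-- The relative reduced Betti number of a pair `L ⊆ K` of simplicial complexes in degree `d`,
with coefficients in `k`: the dimension of relative cycles modulo relative boundaries (the homology
of the quotient of the augmented chain complexes). If `L` is void, this is the reduced Betti
number of `K`. -/
noncomputable def relBetti (K L : Set (Finset α)) (d : ℤ) : ℕ :=
  quotientDim k (relCycles k K L d) (relBoundaries k K L d)

end Homology

/-- Binary trees whose interior vertices are labeled with elements of `α` and whose leaves are
labeled with an element of `P` or with the symbol `N`, "not a face". The first subtree of an
interior vertex labeled `x` is for the sets containing `x`, the second for those that do not. -/
inductive FTree (α P : Type*) where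
  | value (p : P) : FTree α P
  | notFace : FTree α P
  | query (x : α) (yes no : FTree α P) : FTree α P

/-- The number of queries made when the tree is run on the set `σ`. -/
def FTree.queries {α P : Type*} [DecidableEq α] : FTree α P → Finset α → ℕ
  | .value _, _ => 0
  | .notFace, _ => 0
  | .query x yes no, σ => (if x ∈ σ then yes.queries σ else no.queries σ) + 1

/-- `IsDecisionTree Δ f T`: the tree `T` is an (element) decision tree for `f : Δ → P`.
It is a leaf labeled `p` if `Δ` consists of all subsets of the ground set and `f` is constant with
value `p`; otherwise the root queries an element `x` of the ground set and the subtrees are a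
decision tree for the link `f_{/x}` (the leaf `N` if `x` is not a vertex) and one for the
deletion of `x`. -/
inductive IsDecisionTree {α P : Type*} [DecidableEq α] :
    FinComplex α → (Finset α → P) → FTree α P → Prop
  | leaf (Δ : FinComplex α) (f : Finset α → P) (p : P)
      (simplex : ∀ σ, σ ⊆ Δ.ground → σ ∈ Δ.faces)
      (const : ∀ σ ∈ Δ.faces, f σ = p) :
      IsDecisionTree Δ f (.value p)
  | nonvertex (Δ : FinComplex α) (f : Finset α → P) (x : α) (no : FTree α P)
      (mem : x ∈ Δ.ground) (not_vertex : {x} ∉ Δ.faces)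
      (deletion : IsDecisionTree (Δ.deletion x) f no) :
      IsDecisionTree Δ f (.query x .notFace no)
  | vertex (Δ : FinComplex α) (f : Finset α → P) (x : α) (yes no : FTree α P)
      (mem : x ∈ Δ.ground) (is_vertex : {x} ∈ Δ.faces)
      (link : IsDecisionTree (Δ.link x) (fun τ => f (insert x τ)) yes)
      (deletion : IsDecisionTree (Δ.deletion x) f no) :
      IsDecisionTree Δ f (.query x yes no)

open Classical in
/-- The number of `p`-evasive faces of cardinality `i`: the faces `σ` with `f σ = p` on which the
tree queries all elements of the ground set. -/
noncomputable def evasiveCount {α P : Type*} [DecidableEq α] (Δ : FinComplex α)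
    (f : Finset α → P) (T : FTree α P) (p : P) (i : ℕ) : ℕ :=
  (Δ.faces.filter
    (fun σ => f σ = p ∧ T.queries σ = Δ.ground.card ∧ σ.card = i)).card

/-- A decision tree is optimal if for all `p` and `i` the number of `p`-evasive faces of
cardinality `i`, i.e. of dimension `i - 1`, is the relative reduced Betti number of
`(Δ_{≤ p}, Δ_{< p})` in degree `i - 1`. -/
def IsOptimalTree (k : Type*) [Field k] {α P : Type*} [LinearOrder α] [PartialOrder P]
    (Δ : FinComplex α) (f : Finset α → P) (T : FTree α P) : Prop :=
  IsDecisionTree Δ f T ∧ ∀ (p : P) (i : ℕ),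
    evasiveCount Δ f T p i = relBetti k (Δ.sublevel f p) (Δ.strictSublevel f p) ((i : ℤ) - 1)

/-- A monotone function is homology decidable (over `k`) if it has an optimal decision tree. -/
def HomologyDecidable (k : Type*) [Field k] {α P : Type*} [LinearOrder α] [PartialOrder P]
    (Δ : FinComplex α) (f : Finset α → P) : Prop :=
  Δ.MonotoneFun f ∧ ∃ T : FTree α P, IsOptimalTree k Δ f T

/-- A complex is semi-nonevasive (over `k`) if the constant function on it is homology
decidable. -/
def SemiNonevasive (k : Type*) [Field k] {α : Type*} [LinearOrder α] (Δ : FinComplex α) : Prop :=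
  HomologyDecidable k Δ (fun _ => ())

/-- The Poincaré polynomial of a monotone `f : Δ → ℕ` in the variables `q = X 0`, `x = X 1`:
`P(f; q, x) = ∑_{i, j ≥ 0} β̃_{i-1}(Δ_{≤ j}, Δ_{< j}) q^i x^j`. (Only finitely many terms are
nonzero, since there are finitely many faces.) -/
noncomputable def poincarePoly (k : Type*) [Field k] {α : Type*} [LinearOrder α]
    (Δ : FinComplex α) (f : Finset α → ℕ) : MvPolynomial (Fin 2) ℤ :=
  ∑ᶠ ij : ℕ × ℕ,
    MvPolynomial.C
      (relBetti k (Δ.sublevel f ij.2) (Δ.strictSublevel f ij.2) ((ij.1 : ℤ) - 1) : ℤ) *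
      MvPolynomial.X 0 ^ ij.1 * MvPolynomial.X 1 ^ ij.2

/-- The Poincaré polynomial of a complex: `P(Δ; q) = ∑_{i ≥ 0} β̃_{i-1}(Δ) q^i`. -/
noncomputable def complexPoincarePoly (k : Type*) [Field k] {α : Type*} [LinearOrder α]
    (Δ : FinComplex α) : Polynomial ℤ :=
  ∑ᶠ i : ℕ,
    Polynomial.C (relBetti k {σ | σ ∈ Δ.faces} ∅ ((i : ℤ) - 1) : ℤ) * Polynomial.X ^ i

/-- A semimatroid `(S, Δ, r)` on the finite set `S = Δ.ground`. Only the values of the rank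
function on faces matter. -/
structure Semimatroid (α : Type*) [DecidableEq α] where
  /-- the complex of central sets, over the ground set `S` -/
  Δ : FinComplex α
  /-- the rank function -/
  r : Finset α → ℕ
  nonvoid : Δ.faces.Nonempty
  rank_le_card : ∀ σ ∈ Δ.faces, r σ ≤ σ.card
  rank_mono : ∀ σ ∈ Δ.faces, ∀ τ ∈ Δ.faces, σ ⊆ τ → r σ ≤ r τ
  submodular : ∀ σ ∈ Δ.faces, ∀ τ ∈ Δ.faces, σ ∪ τ ∈ Δ.faces →
    r (σ ∪ τ) + r (σ ∩ τ) ≤ r σ + r τ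
  union_mem : ∀ σ ∈ Δ.faces, ∀ τ ∈ Δ.faces, r σ = r (σ ∩ τ) → σ ∪ τ ∈ Δ.faces
  exchange : ∀ σ ∈ Δ.faces, ∀ τ ∈ Δ.faces, r σ < r τ → ∃ y ∈ τ \ σ, insert y σ ∈ Δ.faces

namespace Semimatroid

variable {α : Type*} [DecidableEq α]

/-- The nullity function `n(σ) = |σ| - r(σ)`. -/
def nullity (C : Semimatroid α) (σ : Finset α) : ℕ := σ.card - C.r σ

/-- A face is independent if it is not dependent, i.e. not `r(σ) < |σ|`. -/
def Indep (C : Semimatroid α) (σ : Finset α) : Prop := σ ∈ C.Δ.faces ∧ ¬ C.r σ < σ.card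

/-- A basis is a maximal independent set. -/
def IsBasis (C : Semimatroid α) (σ : Finset α) : Prop := Maximal C.Indep σ

open Classical in
/-- The rank `r_C` of a semimatroid: the common cardinality of its bases. -/
noncomputable def rank (C : Semimatroid α) : ℕ :=
  (C.Δ.faces.filter (fun σ => C.IsBasis σ)).sup Finset.card

/-- The Tutte polynomial `T_C(x, y) = ∑_{σ ∈ Δ} (x-1)^{r_C - r(σ)} (y-1)^{|σ| - r(σ)}`, with
`x = X 0` and `y = X 1`. -/
noncomputable def tutte (C : Semimatroid α) : MvPolynomial (Fin 2) ℤ :=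
  ∑ σ ∈ C.Δ.faces, (MvPolynomial.X 0 - 1) ^ (C.rank - C.r σ) *
    (MvPolynomial.X 1 - 1) ^ (σ.card - C.r σ)

/-- The value `T_C(a, b)` of the Tutte polynomial at elements of a commutative ring. -/
noncomputable def tutteAt (C : Semimatroid α) {R : Type*} [CommRing R] (a b : R) : R :=
  MvPolynomial.aeval ![a, b] C.tutte

end Semimatroid

/-!
# Homology decision trees of semimatroids

A decision tree for a monotone `f : Δ → P` splits `Δ` into Boolean intervals on which `f` is
constant; the evasive faces are the intervals with one element. As in discrete Morse theory, the
evasive faces of value `p` bound the homology of the pair `(Δ_{≤ p}, Δ_{< p})`: a value and a degree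
without evasive faces have no homology (`IsDecisionTree.relCycles_le_relBoundaries`). This goes by
induction on the tree. A chain splits into a chain of the deletion and a cone over a chain of the
link, and the formula `∂ h + h ∂ = id` for the cone operator `h` (`simplicialBoundary_coneMap`)
takes the place of the long exact sequence. On the other hand non-evasive faces cancel in
alternating sums (`IsDecisionTree.sum_evasiveFaces`).

Hence a tree is optimal as soon as the cardinality of an evasive face depends only on its value
(`IsDecisionTree.isOptimalTree`): the homology of each pair is then concentrated in one degree, where
its dimension is the number of evasive faces by the Euler–Poincaré formula
(`sum_neg_one_pow_mul_relBetti`). In this case the Poincaré polynomial is a signed sum over all faces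
(`poincarePoly_eq_sum_faces`), to be compared term by term with the sum that defines the Tutte
polynomial.

It remains to find such trees for a semimatroid, by deletion and contraction. Querying only elements
that are not loops makes the evasive faces independent, so they have cardinality `r`. Querying only
elements that do not lie in all faces of full rank makes them of full rank, so they have cardinality
`r_C` plus nullity. Querying only elements with both properties makes them bases, of cardinality
`r_C`. When no element may be queried any more, the complex is a simplex and the function in question
is constant on it.
-/

/-! ### The boundary map and cones -/

section Cone

variable {α : Type*} [LinearOrder α] (k : Type*) [Field k]

/-- The sign `(-1)^{#{y ∈ σ : y < x}}`, which gives the position of `x` among the vertices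
of `σ`. -/
def orientationSign (x : α) (σ : Finset α) : k := (-1) ^ (σ.filter (fun y => y < x)).card

lemma orientationSign_mul_self (x : α) (σ : Finset α) :
    orientationSign k x σ * orientationSign k x σ = 1 := by
  rw [orientationSign, ← mul_pow]
  simp

lemma orientationSign_ne_zero (x : α) (σ : Finset α) : orientationSign k x σ ≠ 0 :=
  left_ne_zero_of_mul_eq_one (orientationSign_mul_self k x σ)

lemma orientationSign_insert_of_lt {x y : α} {σ : Finset α} (hx : x ∉ σ) (h : x < y) :
    orientationSign k y (insert x σ) = -orientationSign k y σ := by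
  rw [orientationSign, orientationSign, Finset.filter_insert, if_pos h,
    Finset.card_insert_of_notMem (by simp [hx]), pow_succ]
  ring

lemma orientationSign_insert_of_le {x y : α} {σ : Finset α} (h : y ≤ x) :
    orientationSign k y (insert x σ) = orientationSign k y σ := by
  rw [orientationSign, orientationSign, Finset.filter_insert, if_neg h.not_gt]

/-- Removing `y` from `σ ∪ {x}` and adding `x` to `σ` are anticommuting operations on oriented
simplices. -/
lemma orientationSign_anticomm {x y : α} {σ : Finset α} (hx : x ∉ σ) (hy : y ∈ σ) :
    orientationSign k x σ * orientationSign k y (insert x σ) =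
      -(orientationSign k y σ * orientationSign k x (σ.erase y)) := by
  have hσ : insert y (σ.erase y) = σ := Finset.insert_erase hy
  rcases lt_trichotomy x y with h | h | h
  · rw [orientationSign_insert_of_lt k hx h]
    have := orientationSign_insert_of_le k (σ := σ.erase y) h.le
    rw [hσ] at this
    rw [this]
    ring
  · exact absurd (h ▸ hy) hx
  · rw [orientationSign_insert_of_le k h.le]
    have := orientationSign_insert_of_lt k (Finset.notMem_erase y σ) h
    rw [hσ] at this
    rw [this]
    ring

lemma simplicialBoundary_single (σ : Finset α) :
    simplicialBoundary k (Finsupp.single σ 1) =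
      ∑ x ∈ σ, Finsupp.single (σ.erase x) (orientationSign k x σ) := by
  simp [simplicialBoundary, orientationSign]

/-- The cone over a chain with apex `x`: it sends an oriented simplex `σ` to the oriented simplex
`x ∗ σ` if `x ∉ σ` and to `0` otherwise (the exterior multiplication by `x`). -/
noncomputable def coneMap (x : α) : (Finset α →₀ k) →ₗ[k] (Finset α →₀ k) :=
  Finsupp.linearCombination k (fun σ : Finset α =>
    if x ∈ σ then 0 else Finsupp.single (insert x σ) (orientationSign k x σ))

variable {k}

lemma coneMap_single (x : α) (σ : Finset α) (a : k) :
    coneMap k x (Finsupp.single σ a) =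
      if x ∈ σ then 0 else Finsupp.single (insert x σ) (a * orientationSign k x σ) := by
  rw [coneMap, Finsupp.linearCombination_single]
  split_ifs <;> simp

/-- The cone with apex `x` is a contracting homotopy of the augmented chain complex of all finite
sets. -/
lemma simplicialBoundary_coneMap (x : α) (c : Finset α →₀ k) :
    simplicialBoundary k (coneMap k x c) = c - coneMap k x (simplicialBoundary k c) := by
  suffices h : simplicialBoundary k ∘ₗ coneMap k x + coneMap k x ∘ₗ simplicialBoundary k =
      LinearMap.id from eq_sub_of_add_eq (LinearMap.congr_fun h c)
  refine Finsupp.lhom_ext' fun σ => LinearMap.ext_ring ?_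
  simp only [LinearMap.comp_apply, Finsupp.lsingle_apply, LinearMap.add_apply, LinearMap.id_apply]
  rw [simplicialBoundary_single, map_sum, coneMap_single]
  simp only [coneMap_single]
  split_ifs with hx
  · rw [map_zero, zero_add, Finset.sum_eq_single_of_mem x hx]
    · have := orientationSign_insert_of_le k (σ := σ.erase x) (le_refl x)
      rw [Finset.insert_erase hx] at this
      rw [if_neg (Finset.notMem_erase x σ), Finset.insert_erase hx, ← this,
        orientationSign_mul_self]
    · intro y _ hyx
      rw [if_pos (Finset.mem_erase.2 ⟨hyx.symm, hx⟩)]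
  · have hsmul : Finsupp.single (insert x σ) (1 * orientationSign k x σ) =
        orientationSign k x σ • Finsupp.single (insert x σ) (1 : k) := by
      rw [Finsupp.smul_single, smul_eq_mul, one_mul, mul_one]
    rw [hsmul, (simplicialBoundary k).map_smul, simplicialBoundary_single, Finset.sum_insert hx, Finset.erase_insert hx, smul_add,
      orientationSign_insert_of_le k (le_refl x), Finsupp.smul_single, smul_eq_mul,
      orientationSign_mul_self, add_assoc, Finset.smul_sum, ← Finset.sum_add_distrib,
      Finset.sum_eq_zero, add_zero]
    intro y hy
    have hyx : x ≠ y := fun h => hx (h ▸ hy)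
    rw [if_neg (fun h => hx (Finset.mem_of_mem_erase h)), Finsupp.smul_single, smul_eq_mul,
      Finset.erase_insert_of_ne hyx, ← Finsupp.single_add, orientationSign_anticomm k hx hy,
      neg_add_cancel, Finsupp.single_zero]

/-- `∂ ∘ ∂ = 0`. By the homotopy formula `∂∂` commutes with cones, and every simplex is an iterated
cone over the empty face. -/
lemma simplicialBoundary_simplicialBoundary (c : Finset α →₀ k) :
    simplicialBoundary k (simplicialBoundary k c) = 0 := by
  suffices h : simplicialBoundary k ∘ₗ simplicialBoundary k = 0 by
    rw [← LinearMap.comp_apply, h, LinearMap.zero_apply]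
  refine Finsupp.lhom_ext' fun σ => LinearMap.ext_ring ?_
  simp only [LinearMap.comp_apply, Finsupp.lsingle_apply, LinearMap.zero_apply]
  induction σ using Finset.induction_on with
  | empty => simp [simplicialBoundary_single]
  | insert x σ hx ih =>
    have hcone : Finsupp.single (insert x σ) (1 : k) =
        orientationSign k x σ • coneMap k x (Finsupp.single σ 1) := by
      rw [coneMap_single, if_neg hx, Finsupp.smul_single, smul_eq_mul, one_mul,
        orientationSign_mul_self]
    rw [hcone, map_smul, map_smul, simplicialBoundary_coneMap, map_sub, simplicialBoundary_coneMap,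
      ih, map_zero, sub_zero, sub_self, smul_zero]

lemma coneMap_apply_insert {x : α} {τ : Finset α} (hx : x ∉ τ) (c : Finset α →₀ k) :
    coneMap k x c (insert x τ) = c τ * orientationSign k x τ := by
  induction c using Finsupp.induction_linear with
  | zero => simp
  | add c d hc hd => rw [map_add, Finsupp.add_apply, hc, hd, Finsupp.add_apply, add_mul]
  | single σ a =>
    rw [coneMap_single]
    by_cases h : σ = τ
    · subst h
      simp [hx]
    · rw [Finsupp.single_eq_of_ne (Ne.symm h), zero_mul]
      split_ifs with hσ
      · rfl
      · rw [Finsupp.single_eq_of_ne]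
        intro h'
        apply h
        rw [← Finset.erase_insert hσ, ← h', Finset.erase_insert hx]

lemma coneMap_mem_supported {x : α} {A B : Set (Finset α)}
    (h : ∀ σ ∈ A, x ∉ σ → insert x σ ∈ B) {c : Finset α →₀ k} (hc : c ∈ Finsupp.supported k k A) :
    coneMap k x c ∈ Finsupp.supported k k B := by
  rw [Finsupp.supported_eq_span_single] at hc
  have h' : Submodule.span k ((fun i => Finsupp.single i (1 : k)) '' A) ≤
      (Finsupp.supported k k B).comap (coneMap k x) := by
    rw [Submodule.span_le]
    rintro _ ⟨σ, hσ, rfl⟩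
    change coneMap k x (Finsupp.single σ 1) ∈ Finsupp.supported k k B
    rw [coneMap_single]
    split_ifs with hx
    · exact Submodule.zero_mem _
    · exact Finsupp.single_mem_supported k _ (h σ hσ hx)
  exact h' hc

lemma simplicialBoundary_mem_supported {A B : Set (Finset α)}
    (h : ∀ σ ∈ A, ∀ x ∈ σ, σ.erase x ∈ B) {c : Finset α →₀ k}
    (hc : c ∈ Finsupp.supported k k A) :
    simplicialBoundary k c ∈ Finsupp.supported k k B := by
  rw [Finsupp.supported_eq_span_single] at hc
  have h' : Submodule.span k ((fun i => Finsupp.single i (1 : k)) '' A) ≤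
      (Finsupp.supported k k B).comap (simplicialBoundary k) := by
    rw [Submodule.span_le]
    rintro _ ⟨σ, hσ, rfl⟩
    change simplicialBoundary k (Finsupp.single σ 1) ∈ Finsupp.supported k k B
    rw [simplicialBoundary_single]
    exact Submodule.sum_mem _ fun x hx => Finsupp.single_mem_supported k _ (h σ hσ x hx)
  exact h' hc

/-- A chain splits into its part that avoids `x` and a cone with apex `x`. -/
lemma exists_eq_add_coneMap (x : α) {A : Set (Finset α)} {c : Finset α →₀ k}
    (hc : c ∈ Finsupp.supported k k A) :
    ∃ c₀ ∈ Finsupp.supported k k {σ | σ ∈ A ∧ x ∉ σ},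
      ∃ c₁ ∈ Finsupp.supported k k {σ | x ∉ σ ∧ insert x σ ∈ A}, c = c₀ + coneMap k x c₁ := by
  suffices h : Finsupp.supported k k A ≤ Finsupp.supported k k {σ | σ ∈ A ∧ x ∉ σ} ⊔
      (Finsupp.supported k k {σ | x ∉ σ ∧ insert x σ ∈ A}).map (coneMap k x) by
    obtain ⟨c₀, h₀, _, ⟨c₁, h₁, rfl⟩, rfl⟩ := Submodule.mem_sup.1 (h hc)
    exact ⟨c₀, h₀, c₁, h₁, rfl⟩
  rw [Finsupp.supported_eq_span_single k A, Submodule.span_le]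
  rintro _ ⟨σ, hσ, rfl⟩
  by_cases hx : x ∈ σ
  · refine Submodule.mem_sup_right ⟨Finsupp.single (σ.erase x) (orientationSign k x (σ.erase x)),
      Finsupp.single_mem_supported k _ ⟨Finset.notMem_erase x σ, ?_⟩, ?_⟩
    · rwa [Finset.insert_erase hx]
    · rw [coneMap_single, if_neg (Finset.notMem_erase x σ), Finset.insert_erase hx,
        orientationSign_mul_self]
  · exact Submodule.mem_sup_left (Finsupp.single_mem_supported k _ ⟨hσ, hx⟩)

end Cone

/-! ### The Euler–Poincaré formula -/

section EulerPoincare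

/-- Rank–nullity for a linear map between two pairs: relative cycles in the source together with
relative boundaries in the target have the dimension of the chains. -/
lemma Submodule.finrank_inf_comap_add_finrank_map_sup {k V : Type*} [Field k] [AddCommGroup V]
    [Module k V] (g : V →ₗ[k] V) (U W : Submodule k V) [FiniteDimensional k U]
    [FiniteDimensional k W] :
    Module.finrank k ↥(U ⊓ W.comap g) + Module.finrank k ↥(U.map g ⊔ W) =
      Module.finrank k U + Module.finrank k W := by
  have rank_nullity : ∀ X : Submodule k V, X ≤ U →
      Module.finrank k ↥(X.map g) + Module.finrank k ↥(X ⊓ LinearMap.ker g) =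
        Module.finrank k X := by
    intro X hX
    have : FiniteDimensional k X := Submodule.finiteDimensional_of_le hX
    have h := LinearMap.finrank_range_add_finrank_ker (g.domRestrict X)
    rw [LinearMap.range_domRestrict, LinearMap.ker_domRestrict] at h
    rw [← h]
    congr 1
    rw [← Submodule.map_comap_subtype]
    exact (Submodule.equivMapOfInjective _ X.injective_subtype _).symm.finrank_eq
  have h₁ := rank_nullity U le_rfl
  have h₂ := rank_nullity (U ⊓ W.comap g) inf_le_left
  have hker : U ⊓ W.comap g ⊓ LinearMap.ker g = U ⊓ LinearMap.ker g := by
    rw [inf_assoc, inf_eq_right.2 (LinearMap.ker_le_comap g)]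
  have hmap : (U ⊓ W.comap g).map g = U.map g ⊓ W := by
    ext v
    simp only [Submodule.mem_map, Submodule.mem_inf, Submodule.mem_comap]
    constructor
    · rintro ⟨u, ⟨hu, hw⟩, rfl⟩
      exact ⟨⟨u, hu, rfl⟩, hw⟩
    · rintro ⟨⟨u, hu, rfl⟩, hw⟩
      exact ⟨u, ⟨hu, hw⟩, rfl⟩
  rw [hker, hmap] at h₂
  have h₃ := Submodule.finrank_sup_add_finrank_inf_eq (U.map g) W
  omega

lemma finrank_simplicialChains {α k : Type*} [DecidableEq α] [Field k] (K : Finset (Finset α)) (d : ℤ) :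
    Module.finrank k (simplicialChains k (K : Set (Finset α)) d) =
      (K.filter fun σ => (σ.card : ℤ) = d + 1).card := by
  have hset : {σ | σ ∈ (K : Set (Finset α)) ∧ (σ.card : ℤ) = d + 1} =
      ↑(K.filter fun σ => (σ.card : ℤ) = d + 1) := by
    ext σ
    simp
  rw [simplicialChains, hset, (Finsupp.supportedEquivFinsupp _).finrank_eq,
    Module.finrank_finsupp_self]
  exact Fintype.card_coe _

instance finiteDimensional_simplicialChains {α k : Type*} [Field k] (K : Finset (Finset α)) (d : ℤ) :
    FiniteDimensional k (simplicialChains k (K : Set (Finset α)) d) := by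
  have hle : simplicialChains k (K : Set (Finset α)) d ≤
      Finsupp.supported k k (K : Set (Finset α)) :=
    Finsupp.supported_mono fun σ hσ => hσ.1
  have : FiniteDimensional k (Finsupp.supported k k (K : Set (Finset α))) :=
    Module.Finite.equiv (Finsupp.supportedEquivFinsupp (K : Set (Finset α))).symm
  exact Submodule.finiteDimensional_of_le hle

lemma simplicialChains_le {α k : Type*} [Field k] {K L : Set (Finset α)} {d e : ℤ}
    (h : ∀ σ ∈ K, (σ.card : ℤ) = d + 1 → σ ∈ L ∧ (σ.card : ℤ) = e + 1) :
    simplicialChains k K d ≤ simplicialChains k L e :=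
  Finsupp.supported_mono fun σ hσ => h σ hσ.1 hσ.2

lemma simplicialChains_mono {α k : Type*} [Field k] {K L : Set (Finset α)} (h : L ⊆ K) (d : ℤ) :
    simplicialChains k L d ≤ simplicialChains k K d :=
  simplicialChains_le fun _ hσ hd => ⟨h hσ, hd⟩

variable {α : Type*} [LinearOrder α] {k : Type*} [Field k]

lemma simplicialBoundary_mem_simplicialChains {K : Set (Finset α)}
    (hK : ∀ σ ∈ K, ∀ x ∈ σ, σ.erase x ∈ K) {d : ℤ} {c : Finset α →₀ k}
    (hc : c ∈ simplicialChains k K d) :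
    simplicialBoundary k c ∈ simplicialChains k K (d - 1) := by
  refine simplicialBoundary_mem_supported (A := {σ | σ ∈ K ∧ (σ.card : ℤ) = d + 1})
    (B := {σ | σ ∈ K ∧ (σ.card : ℤ) = d - 1 + 1}) (fun σ hσ x hx => ⟨hK σ hσ.1 x hx, ?_⟩) hc
  have h₁ := Finset.card_erase_add_one hx
  have h₂ := hσ.2
  omega

lemma coneMap_mem_simplicialChains {K L : Set (Finset α)} {x : α}
    (h : ∀ σ ∈ K, x ∉ σ → insert x σ ∈ L) {d : ℤ} {c : Finset α →₀ k}
    (hc : c ∈ simplicialChains k K d) : coneMap k x c ∈ simplicialChains k L (d + 1) := by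
  refine coneMap_mem_supported (A := {σ | σ ∈ K ∧ (σ.card : ℤ) = d + 1})
    (B := {σ | σ ∈ L ∧ (σ.card : ℤ) = d + 1 + 1}) (fun σ hσ hx => ⟨h σ hσ.1 hx, ?_⟩) hc
  rw [Finset.card_insert_of_notMem hx, Nat.cast_add, hσ.2, Nat.cast_one]

lemma simplicialBoundary_mem_supported_notMem (x : α) {c : Finset α →₀ k}
    (hc : c ∈ Finsupp.supported k k {σ | x ∉ σ}) :
    simplicialBoundary k c ∈ Finsupp.supported k k {σ | x ∉ σ} :=
  simplicialBoundary_mem_supported (A := {σ | x ∉ σ}) (B := {σ | x ∉ σ})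
    (fun _ hσ _ _ h => hσ (Finset.mem_of_mem_erase h)) hc

lemma relBoundaries_le_relCycles {K L : Set (Finset α)}
    (hK : ∀ σ ∈ K, ∀ x ∈ σ, σ.erase x ∈ K) (hL : ∀ σ ∈ L, ∀ x ∈ σ, σ.erase x ∈ L)
    (hLK : L ⊆ K) (d : ℤ) : relBoundaries k K L d ≤ relCycles k K L d := by
  refine sup_le ?_ fun c hc =>
    ⟨simplicialChains_mono hLK d hc, simplicialBoundary_mem_simplicialChains hL hc⟩
  rintro _ ⟨c, hc, rfl⟩
  refine ⟨?_, ?_⟩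
  · have := simplicialBoundary_mem_simplicialChains hK hc
    rwa [add_sub_cancel_right] at this
  · change simplicialBoundary k (simplicialBoundary k c) ∈ simplicialChains k L (d - 1)
    rw [simplicialBoundary_simplicialBoundary]
    exact Submodule.zero_mem _

lemma relBetti_eq_zero {K L : Set (Finset α)} {d : ℤ}
    (h : relCycles k K L d ≤ relBoundaries k K L d) : relBetti k K L d = 0 := by
  rw [relBetti, quotientDim, Submodule.submoduleOf_eq_top.2 h]
  exact Module.finrank_zero_of_subsingleton

lemma relBetti_add_finrank_relBoundaries {K L : Finset (Finset α)}
    (hK : ∀ σ ∈ K, ∀ x ∈ σ, σ.erase x ∈ K) (hL : ∀ σ ∈ L, ∀ x ∈ σ, σ.erase x ∈ L)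
    (hLK : L ⊆ K) (d : ℤ) :
    relBetti k (K : Set (Finset α)) L d + Module.finrank k (relBoundaries k (K : Set (Finset α)) L d)
      = Module.finrank k (relCycles k (K : Set (Finset α)) L d) := by
  have hle := relBoundaries_le_relCycles (k := k) (K := (K : Set (Finset α))) (L := L)
    (by exact_mod_cast hK) (by exact_mod_cast hL) (by exact_mod_cast hLK) d
  have : FiniteDimensional k (relCycles k (K : Set (Finset α)) L d) :=
    Submodule.finiteDimensional_of_le inf_le_left
  rw [relBetti, quotientDim, ← (Submodule.submoduleOfEquivOfLe hle).finrank_eq]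
  exact Submodule.finrank_quotient_add_finrank _

lemma finrank_relCycles_add_finrank_relBoundaries (K L : Finset (Finset α)) (d : ℤ) :
    Module.finrank k (relCycles k (K : Set (Finset α)) L d) +
        Module.finrank k (relBoundaries k (K : Set (Finset α)) L (d - 1)) =
      (K.filter fun σ => (σ.card : ℤ) = d + 1).card + (L.filter fun σ => (σ.card : ℤ) = d).card := by
  have h := Submodule.finrank_inf_comap_add_finrank_map_sup (simplicialBoundary k)
    (simplicialChains k (K : Set (Finset α)) d) (simplicialChains k (L : Set (Finset α)) (d - 1))
  rw [finrank_simplicialChains, finrank_simplicialChains] at h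
  rw [relCycles, relBoundaries, sub_add_cancel]
  simpa only [sub_add_cancel] using h

lemma relBoundaries_eq_of_boundary_eq_zero {K L : Set (Finset α)} {d : ℤ}
    (h : ∀ c ∈ simplicialChains k K (d + 1), simplicialBoundary k c = 0) :
    relBoundaries k K L d = simplicialChains k L d := by
  rw [relBoundaries, sup_eq_right]
  rintro _ ⟨c, hc, rfl⟩
  rw [h c hc]
  exact Submodule.zero_mem _

/-- The Euler–Poincaré formula for a pair of finite simplicial complexes. -/
lemma sum_neg_one_pow_mul_relBetti {K L : Finset (Finset α)}
    (hK : ∀ σ ∈ K, ∀ x ∈ σ, σ.erase x ∈ K) (hL : ∀ σ ∈ L, ∀ x ∈ σ, σ.erase x ∈ L)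
    (hLK : L ⊆ K) {n : ℕ} (hn : ∀ σ ∈ K, σ.card ≤ n) :
    ∑ i ∈ Finset.range (n + 1),
        (-1 : ℤ) ^ i * (relBetti k (K : Set (Finset α)) L ((i : ℤ) - 1) : ℤ) =
      ∑ σ ∈ K, (-1) ^ σ.card - ∑ σ ∈ L, (-1) ^ σ.card := by
  have hcount : ∀ M : Finset (Finset α), (∀ σ ∈ M, σ.card ≤ n) →
      ∑ σ ∈ M, (-1 : ℤ) ^ σ.card =
        ∑ i ∈ Finset.range (n + 1), (-1) ^ i * ((M.filter fun σ => σ.card = i).card : ℤ) := by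
    intro M hM
    rw [← Finset.sum_fiberwise_of_maps_to (t := Finset.range (n + 1)) (g := Finset.card)
      fun σ hσ => Finset.mem_range_succ_iff.2 (hM σ hσ)]
    refine Finset.sum_congr rfl fun i _ => ?_
    rw [Finset.sum_congr rfl (g := fun _ => (-1 : ℤ) ^ i) fun σ hσ => by
      rw [(Finset.mem_filter.1 hσ).2], Finset.sum_const, nsmul_eq_mul, mul_comm]
  obtain ⟨b, hb⟩ : ∃ b : ℤ → ℕ, ∀ d,
      Module.finrank k (relBoundaries k (K : Set (Finset α)) L d) = b d := ⟨_, fun _ => rfl⟩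
  obtain ⟨z, hz⟩ : ∃ z : ℤ → ℕ, ∀ d,
      Module.finrank k (relCycles k (K : Set (Finset α)) L d) = z d := ⟨_, fun _ => rfl⟩
  have hβ := relBetti_add_finrank_relBoundaries (k := k) hK hL hLK
  have hrank := finrank_relCycles_add_finrank_relBoundaries (k := k) K L
  simp only [hb, hz] at hβ hrank
  -- The partial alternating sums telescope up to a term that involves the last boundaries.
  have key : ∀ m : ℕ,
      ∑ i ∈ Finset.range (m + 1),
          (-1 : ℤ) ^ i * (relBetti k (K : Set (Finset α)) L ((i : ℤ) - 1) : ℤ) =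
        ∑ i ∈ Finset.range (m + 1), (-1) ^ i * (((K.filter fun σ => σ.card = i).card : ℤ) -
          ((L.filter fun σ => σ.card = i).card : ℤ)) +
        (-1) ^ m * (((L.filter fun σ => σ.card = m).card : ℤ) -
          (b ((m : ℤ) - 1) : ℤ)) := by
    intro m
    induction m with
    | zero =>
      have h₁ := hβ (-1)
      have h₂ := hrank (-1)
      have h₃ : relBoundaries k (K : Set (Finset α)) L (-1 - 1) =
          simplicialChains k (L : Set (Finset α)) (-1 - 1) := by
        refine relBoundaries_eq_of_boundary_eq_zero fun c hc => ?_
        have := simplicialBoundary_mem_supported (B := ∅) (fun σ hσ x hx => ?_) hc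
        · simpa using this
        · have h := Finset.card_pos.2 ⟨x, hx⟩
          have := hσ.2
          omega
      rw [← hb, h₃, finrank_simplicialChains] at h₂
      have h₄ : (K.filter fun σ => (σ.card : ℤ) = -1 + 1) = K.filter fun σ => σ.card = 0 :=
        Finset.filter_congr fun σ _ => by omega
      have h₅ : (L.filter fun σ => (σ.card : ℤ) = -1 - 1 + 1) =
          L.filter fun σ => (σ.card : ℤ) = -1 := Finset.filter_congr fun σ _ => by omega
      rw [h₄, h₅] at h₂
      rw [Finset.sum_range_one, Finset.sum_range_one, pow_zero, Nat.cast_zero, zero_sub]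
      omega
    | succ m ih =>
      rw [Finset.sum_range_succ, ih, Finset.sum_range_succ _ (m + 1)]
      have h₁ := hβ m
      have h₂ := hrank m
      have h₃ : (K.filter fun σ => (σ.card : ℤ) = m + 1) = K.filter fun σ => σ.card = m + 1 := by
        refine Finset.filter_congr fun σ _ => ?_
        norm_cast
      have h₄ : (L.filter fun σ => (σ.card : ℤ) = m) = L.filter fun σ => σ.card = m := by
        refine Finset.filter_congr fun σ _ => ?_
        norm_cast
      rw [h₃, h₄] at h₂
      push_cast
      rw [add_sub_cancel_right, pow_succ]
      have h₁ := congrArg (Nat.cast : ℕ → ℤ) h₁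
      have h₂ := congrArg (Nat.cast : ℕ → ℤ) h₂
      simp only [Nat.cast_add] at h₁ h₂
      linear_combination (-(-1) ^ m) * (h₁ + h₂)
  -- There are no faces of cardinality `n + 1`, so the remaining term vanishes.
  have hlast : b ((n : ℤ) - 1) = (L.filter fun σ => σ.card = n).card := by
    rw [← hb, relBoundaries_eq_of_boundary_eq_zero, finrank_simplicialChains]
    · exact congrArg Finset.card (Finset.filter_congr fun σ _ => by omega)
    · intro c hc
      have hc' : c ∈ Finsupp.supported k k (∅ : Set (Finset α)) := by
        refine Finsupp.supported_mono (fun σ hσ => ?_) hc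
        have h₁ := hn σ hσ.1
        have h₂ := hσ.2
        omega
      rw [Finsupp.supported_empty, Submodule.mem_bot] at hc'
      rw [hc', map_zero]
  rw [key n, hlast, sub_self, mul_zero, add_zero, hcount K hn,
    hcount L fun σ hσ => hn σ (hLK hσ), ← Finset.sum_sub_distrib]
  exact Finset.sum_congr rfl fun i _ => mul_sub _ _ _

end EulerPoincare

/-! ### Decision trees -/

section DecisionTrees

variable {α P : Type*}

lemma FinComplex.mem_deletion [DecidableEq α] {Δ : FinComplex α} {x : α} {σ : Finset α} :
    σ ∈ (Δ.deletion x).faces ↔ σ ∈ Δ.faces ∧ x ∉ σ :=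
  Finset.mem_filter

lemma FinComplex.mem_link [DecidableEq α] {Δ : FinComplex α} {x : α} {σ : Finset α} :
    σ ∈ (Δ.link x).faces ↔ x ∉ σ ∧ insert x σ ∈ Δ.faces := by
  refine Finset.mem_filter.trans ⟨fun h => h.2, fun h => ⟨?_, h⟩⟩
  exact Δ.down_closed _ h.2 _ (Finset.subset_insert x σ)

lemma FinComplex.MonotoneFun.deletion [DecidableEq α] [PartialOrder P] {Δ : FinComplex α}
    {f : Finset α → P} (hf : Δ.MonotoneFun f) (x : α) : (Δ.deletion x).MonotoneFun f :=
  fun σ hσ τ hτ h => hf σ (mem_deletion.1 hσ).1 τ (mem_deletion.1 hτ).1 h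

lemma FinComplex.MonotoneFun.link [DecidableEq α] [PartialOrder P] {Δ : FinComplex α}
    {f : Finset α → P} (hf : Δ.MonotoneFun f) (x : α) :
    (Δ.link x).MonotoneFun fun τ => f (insert x τ) :=
  fun _ hσ _ hτ h => hf _ (mem_link.1 hσ).2 _ (mem_link.1 hτ).2 (Finset.insert_subset_insert x h)

/-- A decision tree only queries elements of the ground set. -/
lemma IsDecisionTree.queries_insert [DecidableEq α] {Δ : FinComplex α} {f : Finset α → P}
    {T : FTree α P} (hT : IsDecisionTree Δ f T) {y : α} (hy : y ∉ Δ.ground) (σ : Finset α) :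
    T.queries (insert y σ) = T.queries σ := by
  induction hT with
  | leaf => rfl
  | nonvertex Δ f x no mem _ _ ih =>
    have hyx : x ≠ y := fun h => hy (h ▸ mem)
    have hno := ih fun h => hy (Finset.mem_of_mem_erase h)
    simp only [FTree.queries, Finset.mem_insert, hyx, false_or, hno]
  | vertex Δ f x yes no mem _ _ _ ih₁ ih₂ =>
    have hyx : x ≠ y := fun h => hy (h ▸ mem)
    have hyes := ih₁ fun h => hy (Finset.mem_of_mem_erase h)
    have hno := ih₂ fun h => hy (Finset.mem_of_mem_erase h)
    simp only [FTree.queries, Finset.mem_insert, hyx, false_or, hno, hyes]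

/-- The evasive faces of a decision tree: those on which it queries the whole ground set. -/
def evasiveFaces [DecidableEq α] (Δ : FinComplex α) (T : FTree α P) : Finset (Finset α) :=
  Δ.faces.filter fun σ => T.queries σ = Δ.ground.card

lemma mem_evasiveFaces [DecidableEq α] {Δ : FinComplex α} {T : FTree α P} {σ : Finset α} :
    σ ∈ evasiveFaces Δ T ↔ σ ∈ Δ.faces ∧ T.queries σ = Δ.ground.card :=
  Finset.mem_filter

lemma evasiveCount_eq_zero [DecidableEq α] {Δ : FinComplex α} {f : Finset α → P} {T : FTree α P}
    {p : P} {i : ℕ} :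
    evasiveCount Δ f T p i = 0 ↔ ∀ σ ∈ evasiveFaces Δ T, f σ = p → σ.card ≠ i := by
  classical
  rw [evasiveCount, Finset.card_eq_zero, Finset.filter_eq_empty_iff]
  simp only [mem_evasiveFaces]
  grind

lemma mem_evasiveFaces_query_of_notMem [DecidableEq α] {Δ : FinComplex α} {x : α}
    (mem : x ∈ Δ.ground) {yes no : FTree α P} {σ : Finset α} (hx : x ∉ σ) :
    σ ∈ evasiveFaces Δ (.query x yes no) ↔ σ ∈ evasiveFaces (Δ.deletion x) no := by
  have h := Finset.card_erase_add_one mem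
  have hground : (Δ.deletion x).ground.card = (Δ.ground.erase x).card := rfl
  rw [mem_evasiveFaces, mem_evasiveFaces, FinComplex.mem_deletion, and_iff_left hx, hground, ← h,
    FTree.queries, if_neg hx, add_left_inj]

lemma insert_mem_evasiveFaces_query [DecidableEq α] {Δ : FinComplex α} {x : α}
    (mem : x ∈ Δ.ground) {f : Finset α → P} {yes no : FTree α P}
    (hyes : IsDecisionTree (Δ.link x) f yes) {τ : Finset α} (hx : x ∉ τ) :
    insert x τ ∈ evasiveFaces Δ (.query x yes no) ↔ τ ∈ evasiveFaces (Δ.link x) yes := by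
  have h := Finset.card_erase_add_one mem
  have hground : (Δ.link x).ground.card = (Δ.ground.erase x).card := rfl
  have hq := hyes.queries_insert (Finset.notMem_erase x Δ.ground) τ
  rw [mem_evasiveFaces, mem_evasiveFaces, FinComplex.mem_link, and_iff_right hx, hground, ← h,
    FTree.queries, if_pos (Finset.mem_insert_self x τ), add_left_inj, hq]

/-- Sums over a family of sets split according to whether the sets contain `x`. -/
lemma Finset.sum_eq_sum_notMem_add_sum_insert [DecidableEq α] {R : Type*} [AddCommMonoid R]
    {A A₀ A₁ : Finset (Finset α)} (x : α) (h₀ : ∀ σ, x ∉ σ → (σ ∈ A ↔ σ ∈ A₀))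
    (h₁ : ∀ σ, x ∉ σ → (insert x σ ∈ A ↔ σ ∈ A₁)) (hA₀ : ∀ σ ∈ A₀, x ∉ σ)
    (hA₁ : ∀ σ ∈ A₁, x ∉ σ) (g : Finset α → R) :
    ∑ σ ∈ A, g σ = ∑ σ ∈ A₀, g σ + ∑ σ ∈ A₁, g (insert x σ) := by
  rw [← Finset.sum_filter_not_add_sum_filter A (fun σ => x ∈ σ)]
  congr 1
  · refine Finset.sum_congr (Finset.ext fun σ => ?_) fun _ _ => rfl
    rw [Finset.mem_filter]
    exact ⟨fun h => (h₀ σ h.2).1 h.1, fun h => ⟨(h₀ σ (hA₀ σ h)).2 h, hA₀ σ h⟩⟩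
  · refine (Finset.sum_bij (fun σ _ => insert x σ) (fun σ hσ => ?_) (fun σ hσ τ hτ h => ?_)
      (fun σ hσ => ?_) fun _ _ => rfl).symm
    · exact Finset.mem_filter.2 ⟨(h₁ σ (hA₁ σ hσ)).2 hσ, Finset.mem_insert_self x σ⟩
    · rw [← Finset.erase_insert (hA₁ σ hσ), h, Finset.erase_insert (hA₁ τ hτ)]
    · obtain ⟨hσ, hx⟩ := Finset.mem_filter.1 hσ
      refine ⟨σ.erase x, ?_, Finset.insert_erase hx⟩
      rw [← h₁ _ (Finset.notMem_erase x σ), Finset.insert_erase hx]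
      exact hσ

/-- The non-evasive faces cancel in every alternating sum whose terms depend only on the
cardinality and the value of `f`: at a leaf they fill Boolean intervals on which `f` is constant. -/
lemma IsDecisionTree.sum_evasiveFaces [DecidableEq α] {R : Type*} [CommRing R]
    {Δ : FinComplex α} {f : Finset α → P} {T : FTree α P} (hT : IsDecisionTree Δ f T)
    (w : P → R) :
    ∑ σ ∈ evasiveFaces Δ T, (-1) ^ σ.card * w (f σ) = ∑ σ ∈ Δ.faces, (-1) ^ σ.card * w (f σ) := by
  have card_insert : ∀ (x : α) (A : Finset (Finset α)) (f : Finset α → P), (∀ σ ∈ A, x ∉ σ) →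
      ∑ σ ∈ A, (-1) ^ (insert x σ).card * w (f (insert x σ)) =
        -∑ σ ∈ A, (-1) ^ σ.card * w (f (insert x σ)) := by
    intro x A f hA
    rw [← Finset.sum_neg_distrib]
    refine Finset.sum_congr rfl fun σ hσ => ?_
    rw [Finset.card_insert_of_notMem (hA σ hσ), pow_succ]
    ring
  induction hT with
  | leaf Δ f p simplex const =>
    rcases Δ.ground.eq_empty_or_nonempty with h | h
    · refine Finset.sum_congr (Finset.filter_true_of_mem fun σ _ => ?_) fun _ _ => rfl
      rw [h]
      rfl
    · have hfaces : Δ.faces = Δ.ground.powerset := Finset.ext fun σ =>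
        ⟨fun hσ => Finset.mem_powerset.2 (Δ.subset_ground σ hσ),
          fun hσ => simplex σ (Finset.mem_powerset.1 hσ)⟩
      have hev : evasiveFaces Δ (.value p) = ∅ := Finset.filter_false_of_mem fun σ _ =>
        (Finset.card_pos.2 h).ne
      rw [hev, Finset.sum_empty, Finset.sum_congr rfl (g := fun σ => (-1) ^ σ.card * w p)
        fun σ hσ => by rw [const σ hσ], ← Finset.sum_mul, hfaces]
      have := congrArg (Int.cast : ℤ → R) (Finset.sum_powerset_neg_one_pow_card_of_nonempty h)
      push_cast at this
      rw [this, zero_mul]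
  | nonvertex Δ f x no mem not_vertex _ ih =>
    have hΔ : ∀ σ ∈ Δ.faces, x ∉ σ := fun σ hσ hx =>
      not_vertex (Δ.down_closed σ hσ _ (Finset.singleton_subset_iff.2 hx))
    have hdel : (Δ.deletion x).faces = Δ.faces := Finset.filter_true_of_mem hΔ
    rw [← hdel, ← ih]
    refine Finset.sum_congr (Finset.ext fun σ => ?_) fun _ _ => rfl
    by_cases hx : x ∈ σ
    · refine iff_of_false (fun h => ?_) fun h => ?_
      · exact hΔ σ (Finset.mem_filter.1 h).1 hx
      · exact (FinComplex.mem_deletion.1 (Finset.mem_filter.1 h).1).2 hx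
    · exact mem_evasiveFaces_query_of_notMem mem hx
  | vertex Δ f x yes no mem is_vertex link _ ih₁ ih₂ =>
    have hlink : ∀ σ ∈ (Δ.link x).faces, x ∉ σ := fun σ hσ => (FinComplex.mem_link.1 hσ).1
    have hdel : ∀ σ ∈ (Δ.deletion x).faces, x ∉ σ := fun σ hσ => (FinComplex.mem_deletion.1 hσ).2
    have hlink' : ∀ σ ∈ evasiveFaces (Δ.link x) yes, x ∉ σ := fun σ hσ =>
      hlink σ (Finset.mem_filter.1 hσ).1
    rw [Finset.sum_eq_sum_notMem_add_sum_insert x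
        (fun σ hx => mem_evasiveFaces_query_of_notMem mem hx)
        (fun σ hx => insert_mem_evasiveFaces_query mem link hx)
        (fun σ hσ => hdel σ (Finset.mem_filter.1 hσ).1) hlink',
      Finset.sum_eq_sum_notMem_add_sum_insert (A := Δ.faces) x
        (fun σ hx => by rw [FinComplex.mem_deletion]; exact (and_iff_left hx).symm)
        (fun σ hx => by rw [FinComplex.mem_link]; exact (and_iff_right hx).symm) hdel hlink,
      card_insert x _ f hlink', card_insert x _ f hlink, ih₁, ih₂]

end DecisionTrees

/-! ### Homology of sublevel complexes and evasive faces -/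

section WeakMorse

variable {α P : Type*} [LinearOrder α] [PartialOrder P] {k : Type*} [Field k]

/-- The step of the weak Morse inequalities: if the pair of sublevel complexes of the deletion has
no homology in degree `d` and that of the link has none in degree `d - 1`, then that of `Δ` has
none in degree `d`. -/
lemma relCycles_le_relBoundaries_of_link_of_deletion {Δ : FinComplex α} {f : Finset α → P}
    (hf : Δ.MonotoneFun f) (x : α) (p : P) (d : ℤ)
    (hlink : relCycles k ((Δ.link x).sublevel (fun τ => f (insert x τ)) p)
        ((Δ.link x).strictSublevel (fun τ => f (insert x τ)) p) (d - 1) ≤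
      relBoundaries k ((Δ.link x).sublevel (fun τ => f (insert x τ)) p)
        ((Δ.link x).strictSublevel (fun τ => f (insert x τ)) p) (d - 1))
    (hdel : relCycles k ((Δ.deletion x).sublevel f p) ((Δ.deletion x).strictSublevel f p) d ≤
      relBoundaries k ((Δ.deletion x).sublevel f p) ((Δ.deletion x).strictSublevel f p) d) :
    relCycles k (Δ.sublevel f p) (Δ.strictSublevel f p) d ≤
      relBoundaries k (Δ.sublevel f p) (Δ.strictSublevel f p) d := by
  rintro z ⟨hz, hdz⟩
  change simplicialBoundary k z ∈ simplicialChains k (Δ.strictSublevel f p) (d - 1) at hdz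
  obtain ⟨z₀, hz₀, z₁, hz₁, rfl⟩ := exists_eq_add_coneMap x hz
  have avoid₀ : simplicialBoundary k z₀ ∈ Finsupp.supported k k {σ | x ∉ σ} :=
    simplicialBoundary_mem_supported_notMem x (Finsupp.supported_mono (fun _ hσ => hσ.2) hz₀)
  have avoid₁ : simplicialBoundary k z₁ ∈ Finsupp.supported k k {σ | x ∉ σ} :=
    simplicialBoundary_mem_supported_notMem x (Finsupp.supported_mono (fun _ hσ => hσ.1) hz₁)
  -- The cone part `z₁` of a relative cycle is a relative cycle of the link.
  have hcyc₁ : z₁ ∈ relCycles k ((Δ.link x).sublevel (fun τ => f (insert x τ)) p)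
      ((Δ.link x).strictSublevel (fun τ => f (insert x τ)) p) (d - 1) := by
    refine ⟨(Finsupp.supported_mono fun τ hτ => ?_ :
      _ ≤ simplicialChains k ((Δ.link x).sublevel (fun τ => f (insert x τ)) p) (d - 1)) hz₁, ?_⟩
    · refine ⟨⟨FinComplex.mem_link.2 ⟨hτ.1, hτ.2.1.1⟩, hτ.2.1.2⟩, ?_⟩
      have h := hτ.2.2
      rw [Finset.card_insert_of_notMem hτ.1] at h
      push_cast at h
      linarith
    · change simplicialBoundary k z₁ ∈ simplicialChains k
        ((Δ.link x).strictSublevel (fun τ => f (insert x τ)) p) (d - 1 - 1)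
      rw [simplicialChains, Finsupp.mem_supported']
      intro τ hτ
      by_cases hx : x ∈ τ
      · exact (Finsupp.mem_supported' k _).1 avoid₁ τ (not_not_intro hx)
      have h₁ : simplicialBoundary k (z₀ + coneMap k x z₁) (insert x τ) = 0 := by
        refine (Finsupp.mem_supported' k _).1 hdz _ fun h => hτ ?_
        refine ⟨⟨FinComplex.mem_link.2 ⟨hx, h.1.1⟩, h.1.2⟩, ?_⟩
        have h := h.2
        rw [Finset.card_insert_of_notMem hx] at h
        push_cast at h
        linarith
      have h₂ : simplicialBoundary k z₀ (insert x τ) = 0 :=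
        (Finsupp.mem_supported' k _).1 avoid₀ _ (not_not_intro (Finset.mem_insert_self x τ))
      have h₃ : z₁ (insert x τ) = 0 := (Finsupp.mem_supported' k _).1 hz₁ _ fun h =>
        h.1 (Finset.mem_insert_self x τ)
      rw [map_add, simplicialBoundary_coneMap, Finsupp.add_apply, Finsupp.sub_apply, h₂, h₃,
        coneMap_apply_insert hx, zero_add, zero_sub, neg_eq_zero] at h₁
      exact (mul_eq_zero.1 h₁).resolve_right (orientationSign_ne_zero k x τ)
  obtain ⟨_, ⟨b₁, hb₁, rfl⟩, l₁, hl₁, hsum₁⟩ := Submodule.mem_sup.1 (hlink hcyc₁)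
  rw [SetLike.mem_coe, sub_add_cancel] at hb₁
  have hb₁' : coneMap k x b₁ ∈ simplicialChains k (Δ.sublevel f p) (d + 1) :=
    coneMap_mem_simplicialChains (L := Δ.sublevel f p)
      (fun τ hτ _ => ⟨(FinComplex.mem_link.1 hτ.1).2, hτ.2⟩) hb₁
  have hl₁' : coneMap k x l₁ ∈ simplicialChains k (Δ.strictSublevel f p) d := by
    rw [← sub_add_cancel d 1]
    exact coneMap_mem_simplicialChains (L := Δ.strictSublevel f p)
      (fun τ hτ _ => ⟨(FinComplex.mem_link.1 hτ.1).2, hτ.2⟩) hl₁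
  have hL : ∀ σ ∈ Δ.strictSublevel f p, ∀ y ∈ σ, σ.erase y ∈ Δ.strictSublevel f p := by
    intro σ hσ y _
    have h := Δ.down_closed σ hσ.1 _ (Finset.erase_subset y σ)
    exact ⟨h, (hf _ h _ hσ.1 (Finset.erase_subset y σ)).trans_lt hσ.2⟩
  have hrel : z₀ + coneMap k x z₁ =
      z₀ + b₁ - simplicialBoundary k (coneMap k x b₁) + coneMap k x l₁ := by
    rw [← hsum₁, map_add, simplicialBoundary_coneMap]
    abel
  -- Subtracting relative boundaries of `Δ` leaves a relative cycle of the deletion.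
  have hcyc₀ : z₀ + b₁ ∈ relCycles k ((Δ.deletion x).sublevel f p)
      ((Δ.deletion x).strictSublevel f p) d := by
    have hchain : z₀ + b₁ ∈ simplicialChains k ((Δ.deletion x).sublevel f p) d := by
      refine Submodule.add_mem _ ((Finsupp.supported_mono fun τ hτ =>
        ⟨⟨FinComplex.mem_deletion.2 ⟨hτ.1.1.1, hτ.2⟩, hτ.1.1.2⟩, hτ.1.2⟩ :
          _ ≤ simplicialChains k ((Δ.deletion x).sublevel f p) d) hz₀)
        (simplicialChains_mono (fun τ hτ => ?_) d hb₁)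
      obtain ⟨hx, hτ'⟩ := FinComplex.mem_link.1 hτ.1
      have hτ'' := Δ.down_closed _ hτ' _ (Finset.subset_insert x τ)
      exact ⟨FinComplex.mem_deletion.2 ⟨hτ'', hx⟩,
        (hf _ hτ'' _ hτ' (Finset.subset_insert x τ)).trans hτ.2⟩
    refine ⟨hchain, ?_⟩
    have h₁ : simplicialBoundary k (z₀ + b₁) ∈ simplicialChains k (Δ.strictSublevel f p) (d - 1) := by
      have heq : z₀ + b₁ = z₀ + coneMap k x z₁ + simplicialBoundary k (coneMap k x b₁) -
          coneMap k x l₁ := by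
        rw [hrel]
        abel
      rw [heq, map_sub, map_add, simplicialBoundary_simplicialBoundary, add_zero]
      exact Submodule.sub_mem _ hdz (simplicialBoundary_mem_simplicialChains hL hl₁')
    have h₂ : simplicialBoundary k (z₀ + b₁) ∈ Finsupp.supported k k {σ | x ∉ σ} :=
      simplicialBoundary_mem_supported_notMem x (Finsupp.supported_mono
        (fun σ hσ => (FinComplex.mem_deletion.1 hσ.1.1).2) hchain)
    rw [SetLike.mem_coe, Submodule.mem_comap, simplicialChains, Finsupp.mem_supported]
    intro σ hσ
    have h₁ := (Finsupp.mem_supported k _).1 h₁ hσ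
    have h₂ := (Finsupp.mem_supported k _).1 h₂ hσ
    exact ⟨⟨FinComplex.mem_deletion.2 ⟨h₁.1.1, h₂⟩, h₁.1.2⟩, h₁.2⟩
  obtain ⟨_, ⟨b₀, hb₀, rfl⟩, l₀, hl₀, hsum₀⟩ := Submodule.mem_sup.1 (hdel hcyc₀)
  have hb₀' : b₀ ∈ simplicialChains k (Δ.sublevel f p) (d + 1) :=
    simplicialChains_mono (K := Δ.sublevel f p)
      (fun τ hτ => ⟨(FinComplex.mem_deletion.1 hτ.1).1, hτ.2⟩) (d + 1) hb₀
  have hl₀' : l₀ ∈ simplicialChains k (Δ.strictSublevel f p) d :=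
    simplicialChains_mono (K := Δ.strictSublevel f p)
      (fun τ hτ => ⟨(FinComplex.mem_deletion.1 hτ.1).1, hτ.2⟩) d hl₀
  refine Submodule.mem_sup.2 ⟨simplicialBoundary k (b₀ - coneMap k x b₁),
    ⟨_, Submodule.sub_mem _ hb₀' hb₁', rfl⟩, l₀ + coneMap k x l₁, Submodule.add_mem _ hl₀' hl₁', ?_⟩
  rw [hrel, ← hsum₀, map_sub]
  abel

/-- A pair of complexes that are cones with the same apex (or void) has no relative homology. -/
lemma relCycles_le_relBoundaries_of_cone {K L : Set (Finset α)} (x : α)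
    (hK : ∀ σ ∈ K, insert x σ ∈ K) (hL : ∀ σ ∈ L, insert x σ ∈ L) (d : ℤ) :
    relCycles k K L d ≤ relBoundaries k K L d := by
  rintro z ⟨hz, hdz⟩
  have hdz' := coneMap_mem_simplicialChains (fun σ hσ _ => hL σ hσ) hdz
  rw [sub_add_cancel] at hdz'
  refine Submodule.mem_sup.2 ⟨_, ⟨coneMap k x z, ?_, rfl⟩, _, hdz', ?_⟩
  · exact coneMap_mem_simplicialChains (fun σ hσ _ => hK σ hσ) hz
  · rw [simplicialBoundary_coneMap, sub_add_cancel]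

/-- Homology in degree `d` at the value `p` forces an evasive face of dimension `d` with value
`p`. -/
lemma IsDecisionTree.relCycles_le_relBoundaries {Δ : FinComplex α} {f : Finset α → P}
    {T : FTree α P} (hT : IsDecisionTree Δ f T) (hf : Δ.MonotoneFun f) {p : P} {d : ℤ}
    (hev : ∀ σ ∈ evasiveFaces Δ T, f σ = p → (σ.card : ℤ) ≠ d + 1) :
    relCycles k (Δ.sublevel f p) (Δ.strictSublevel f p) d ≤
      relBoundaries k (Δ.sublevel f p) (Δ.strictSublevel f p) d := by
  induction hT generalizing d with
  | leaf Δ f q simplex const =>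
    rcases Δ.ground.eq_empty_or_nonempty with h | ⟨x, hx⟩
    · -- The only face is the empty one and it is evasive, so the two chain spaces agree.
      refine inf_le_left.trans (le_sup_of_le_right (simplicialChains_le
        (L := Δ.strictSublevel f p) fun σ hσ hc =>
          ⟨⟨hσ.1, lt_of_le_of_ne hσ.2 fun hp => hev σ (mem_evasiveFaces.2 ⟨hσ.1, ?_⟩) hp hc⟩, hc⟩))
      rw [h]
      rfl
    · have hins : ∀ σ ∈ Δ.faces, insert x σ ∈ Δ.faces := fun σ hσ =>
        simplex _ (Finset.insert_subset hx (Δ.subset_ground σ hσ))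
      refine relCycles_le_relBoundaries_of_cone (K := Δ.sublevel f p)
        (L := Δ.strictSublevel f p) x (fun σ hσ => ⟨hins σ hσ.1, ?_⟩)
        (fun σ hσ => ⟨hins σ hσ.1, ?_⟩) d
      · rw [const _ (hins σ hσ.1), ← const σ hσ.1]
        exact hσ.2
      · rw [const _ (hins σ hσ.1), ← const σ hσ.1]
        exact hσ.2
  | nonvertex Δ f x no mem not_vertex _ ih =>
    have hΔ : ∀ σ ∈ Δ.faces, x ∉ σ := fun σ hσ hx =>
      not_vertex (Δ.down_closed σ hσ _ (Finset.singleton_subset_iff.2 hx))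
    have hdel : (Δ.deletion x).faces = Δ.faces := Finset.filter_true_of_mem hΔ
    have h := ih (hf.deletion x) (d := d) fun σ hσ => hev σ
      ((mem_evasiveFaces_query_of_notMem mem (FinComplex.mem_deletion.1
        (mem_evasiveFaces.1 hσ).1).2).2 hσ)
    rwa [FinComplex.sublevel, FinComplex.strictSublevel, hdel] at h
  | vertex Δ f x yes no mem is_vertex link _ ih₁ ih₂ =>
    refine relCycles_le_relBoundaries_of_link_of_deletion hf x p d
      (ih₁ (hf.link x) fun τ hτ hp h => ?_)
      (ih₂ (hf.deletion x) fun σ hσ => hev σ ((mem_evasiveFaces_query_of_notMem mem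
        (FinComplex.mem_deletion.1 (mem_evasiveFaces.1 hσ).1).2).2 hσ))
    have hx := (FinComplex.mem_link.1 (mem_evasiveFaces.1 hτ).1).1
    refine hev _ ((insert_mem_evasiveFaces_query mem link hx).2 hτ) hp ?_
    rw [Finset.card_insert_of_notMem hx, Nat.cast_add, h]
    ring

/-- A decision tree is optimal if the cardinality of its evasive faces depends only on the value of
`f`: then the homology of each pair of sublevel complexes is concentrated in one degree, where it is
determined by the Euler characteristic. -/
lemma IsDecisionTree.isOptimalTree {Δ : FinComplex α} {f : Finset α → P} {T : FTree α P}
    (hT : IsDecisionTree Δ f T) (hf : Δ.MonotoneFun f) (d : P → ℕ)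
    (hd : ∀ σ ∈ evasiveFaces Δ T, σ.card = d (f σ)) : IsOptimalTree k Δ f T := by
  classical
  have hzero : ∀ p i, evasiveCount Δ f T p i = 0 →
      relBetti k (Δ.sublevel f p) (Δ.strictSublevel f p) ((i : ℤ) - 1) = 0 := by
    intro p i h
    refine relBetti_eq_zero (hT.relCycles_le_relBoundaries hf fun σ hσ hp => ?_)
    rw [sub_add_cancel, Ne, Nat.cast_inj]
    exact evasiveCount_eq_zero.1 h σ hσ hp
  refine ⟨hT, fun p i => ?_⟩
  by_cases h : evasiveCount Δ f T p i = 0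
  · rw [h, hzero p i h]
  obtain ⟨σ₀, hσ₀, hp, rfl⟩ : ∃ σ ∈ evasiveFaces Δ T, f σ = p ∧ σ.card = i := by
    rw [evasiveCount_eq_zero] at h
    push Not at h
    exact h
  have hcard : ∀ σ ∈ evasiveFaces Δ T, f σ = p → σ.card = σ₀.card := by
    intro σ hσ h
    rw [hd σ hσ, hd σ₀ hσ₀, h, hp]
  have hle : ∀ σ ∈ Δ.faces, σ.card ≤ Δ.ground.card := fun σ hσ =>
    Finset.card_le_card (Δ.subset_ground σ hσ)
  have hK : Δ.sublevel f p = ↑(Δ.faces.filter fun σ => f σ ≤ p) := (Finset.coe_filter _ _).symm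
  have hL : Δ.strictSublevel f p = ↑(Δ.faces.filter fun σ => f σ < p) :=
    (Finset.coe_filter _ _).symm
  have euler := sum_neg_one_pow_mul_relBetti (k := k) (K := Δ.faces.filter fun σ => f σ ≤ p)
    (L := Δ.faces.filter fun σ => f σ < p) (n := Δ.ground.card)
    (fun σ hσ y _ => by
      rw [Finset.mem_filter] at hσ ⊢
      have h := Δ.down_closed σ hσ.1 _ (Finset.erase_subset y σ)
      exact ⟨h, (hf _ h _ hσ.1 (Finset.erase_subset y σ)).trans hσ.2⟩)
    (fun σ hσ y _ => by
      rw [Finset.mem_filter] at hσ ⊢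
      have h := Δ.down_closed σ hσ.1 _ (Finset.erase_subset y σ)
      exact ⟨h, (hf _ h _ hσ.1 (Finset.erase_subset y σ)).trans_lt hσ.2⟩)
    (Finset.monotone_filter_right _ fun σ _ h => h.le)
    (fun σ hσ => hle σ (Finset.mem_filter.1 hσ).1)
  rw [← hK, ← hL, Finset.sum_eq_single_of_mem σ₀.card
    (Finset.mem_range_succ_iff.2 (hle σ₀ (mem_evasiveFaces.1 hσ₀).1))] at euler
  swap
  · intro j _ hj
    rw [hzero p j, Nat.cast_zero, mul_zero]
    exact evasiveCount_eq_zero.2 fun σ hσ h hcj => hj (by rw [← hcj, hcard σ hσ h])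
  have hlevel : ∑ σ ∈ Δ.faces.filter (fun σ => f σ ≤ p), (-1 : ℤ) ^ σ.card -
      ∑ σ ∈ Δ.faces.filter (fun σ => f σ < p), (-1 : ℤ) ^ σ.card =
      ∑ σ ∈ Δ.faces, (-1) ^ σ.card * (if f σ = p then 1 else 0) := by
    rw [Finset.sum_filter, Finset.sum_filter, ← Finset.sum_sub_distrib]
    refine Finset.sum_congr rfl fun σ _ => ?_
    rcases eq_or_ne (f σ) p with h | h
    · simp [h]
    · simp [h, le_iff_lt_or_eq]
  rw [hlevel, ← hT.sum_evasiveFaces (fun q => if q = p then (1 : ℤ) else 0)] at euler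
  have hcount : ∑ σ ∈ evasiveFaces Δ T, (-1 : ℤ) ^ σ.card * (if f σ = p then 1 else 0) =
      (-1) ^ σ₀.card * (evasiveCount Δ f T p σ₀.card : ℤ) := by
    have hset : (evasiveFaces Δ T).filter (fun σ => f σ = p) =
        Δ.faces.filter fun σ => f σ = p ∧ T.queries σ = Δ.ground.card ∧ σ.card = σ₀.card := by
      ext σ
      simp only [Finset.mem_filter, mem_evasiveFaces]
      constructor
      · rintro ⟨⟨h₁, h₂⟩, h₃⟩
        exact ⟨h₁, h₃, h₂, hcard σ (mem_evasiveFaces.2 ⟨h₁, h₂⟩) h₃⟩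
      · rintro ⟨h₁, h₂, h₃, -⟩
        exact ⟨⟨h₁, h₃⟩, h₂⟩
    simp only [mul_ite, mul_one, mul_zero]
    rw [← Finset.sum_filter, Finset.sum_congr rfl (g := fun _ => (-1 : ℤ) ^ σ₀.card) fun σ hσ => by
      rw [hcard σ (Finset.mem_filter.1 hσ).1 (Finset.mem_filter.1 hσ).2], Finset.sum_const,
      nsmul_eq_mul, mul_comm, hset, evasiveCount]
  rw [hcount] at euler
  have hunit : ((-1 : ℤ) ^ σ₀.card) ≠ 0 := pow_ne_zero _ (by norm_num)
  exact_mod_cast (mul_left_cancel₀ hunit euler).symm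

end WeakMorse

/-! ### Semimatroids: rank, deletion and contraction -/

namespace Semimatroid

variable {α : Type*} [DecidableEq α] (C : Semimatroid α)

lemma empty_mem : ∅ ∈ C.Δ.faces :=
  C.nonvoid.elim fun σ hσ => C.Δ.down_closed σ hσ ∅ (Finset.empty_subset σ)

lemma rank_empty : C.r ∅ = 0 :=
  Nat.le_zero.1 (C.rank_le_card ∅ C.empty_mem)

variable {C}

lemma singleton_mem {x : α} {σ : Finset α} (hσ : σ ∈ C.Δ.faces) (hx : x ∈ σ) :
    {x} ∈ C.Δ.faces :=
  C.Δ.down_closed σ hσ _ (Finset.singleton_subset_iff.2 hx)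

lemma rank_singleton_le_one {x : α} (hx : {x} ∈ C.Δ.faces) : C.r {x} ≤ 1 :=
  C.rank_le_card _ hx

lemma rank_union_add_rank_inter_le {σ τ : Finset α} (h : σ ∪ τ ∈ C.Δ.faces) :
    C.r (σ ∪ τ) + C.r (σ ∩ τ) ≤ C.r σ + C.r τ :=
  C.submodular σ (C.Δ.down_closed _ h _ Finset.subset_union_left) τ
    (C.Δ.down_closed _ h _ Finset.subset_union_right) h

lemma rank_union_le {σ τ : Finset α} (h : σ ∪ τ ∈ C.Δ.faces) : C.r (σ ∪ τ) ≤ C.r σ + C.r τ :=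
  le_self_add.trans (rank_union_add_rank_inter_le h)

lemma rank_insert_le {x : α} {σ : Finset α} (h : insert x σ ∈ C.Δ.faces) :
    C.r (insert x σ) ≤ C.r σ + C.r {x} := by
  rw [Finset.insert_eq, Finset.union_comm] at h ⊢
  exact rank_union_le h

lemma rank_eq_card_of_subset {σ τ : Finset α} (hτ : τ ∈ C.Δ.faces) (h : C.r τ = τ.card)
    (hστ : σ ⊆ τ) : C.r σ = σ.card := by
  have h₁ := rank_union_le (C := C) (σ := σ) (τ := τ \ σ)
    (by rwa [Finset.union_sdiff_of_subset hστ])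
  rw [Finset.union_sdiff_of_subset hστ] at h₁
  have h₂ := C.rank_le_card _ (C.Δ.down_closed _ hτ _ (Finset.sdiff_subset (t := σ)))
  have h₃ := C.rank_le_card _ (C.Δ.down_closed _ hτ _ hστ)
  have h₄ := Finset.card_sdiff_add_card_eq_card hστ
  omega

/-- Every face contains an independent face of the same rank. -/
lemma exists_subset_rank_eq_card {σ : Finset α} (hσ : σ ∈ C.Δ.faces) :
    ∃ τ ⊆ σ, C.r τ = τ.card ∧ C.r τ = C.r σ := by
  induction σ using Finset.induction_on with
  | empty => exact ⟨∅, subset_rfl, C.rank_empty, rfl⟩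
  | insert x σ hx ih =>
    have hσ' := C.Δ.down_closed _ hσ _ (Finset.subset_insert x σ)
    obtain ⟨τ, hτσ, hτ, hr⟩ := ih hσ'
    have hle := rank_insert_le hσ
    have h1 := rank_singleton_le_one (singleton_mem hσ (Finset.mem_insert_self x σ))
    have hmono := C.rank_mono _ hσ' _ hσ (Finset.subset_insert x σ)
    by_cases heq : C.r (insert x σ) = C.r σ
    · exact ⟨τ, hτσ.trans (Finset.subset_insert x σ), hτ, hr.trans heq.symm⟩
    · refine ⟨insert x τ, Finset.insert_subset_insert x hτσ, ?_⟩
      have hunion : σ ∪ insert x τ = insert x σ := by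
        rw [Finset.union_insert, Finset.union_eq_left.2 hτσ]
      have hinter : σ ∩ insert x τ = τ := by
        rw [Finset.inter_insert_of_notMem hx, Finset.inter_eq_right.2 hτσ]
      have hsub := rank_union_add_rank_inter_le (C := C) (σ := σ) (τ := insert x τ)
        (by rwa [hunion])
      rw [hunion, hinter] at hsub
      have hface := C.Δ.down_closed _ hσ _ (Finset.insert_subset_insert x hτσ)
      have hcard := C.rank_le_card _ hface
      rw [Finset.card_insert_of_notMem fun h => hx (hτσ h)] at hcard ⊢
      omega

lemma indep_iff {σ : Finset α} : C.Indep σ ↔ σ ∈ C.Δ.faces ∧ C.r σ = σ.card :=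
  and_congr_right fun h => not_lt.trans ⟨(C.rank_le_card σ h).antisymm, Eq.ge⟩

lemma exists_isBasis_superset {σ : Finset α} (hσ : C.Indep σ) : ∃ B, σ ⊆ B ∧ C.IsBasis B := by
  have hfin : {τ | C.Indep τ}.Finite :=
    C.Δ.faces.finite_toSet.subset fun τ hτ => hτ.1
  exact hfin.exists_le_maximal hσ

/-- The rank of the semimatroid is the largest rank of a face. -/
lemma rank_le_rank {σ : Finset α} (hσ : σ ∈ C.Δ.faces) : C.r σ ≤ C.rank := by
  classical
  obtain ⟨τ, hτσ, hτ, hr⟩ := exists_subset_rank_eq_card hσ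
  obtain ⟨B, hτB, hB⟩ := exists_isBasis_superset
    (indep_iff.2 ⟨C.Δ.down_closed _ hσ _ hτσ, hτ⟩)
  rw [← hr, hτ]
  refine (Finset.card_le_card hτB).trans ?_
  rw [rank]
  exact Finset.le_sup (f := Finset.card) (Finset.mem_filter.2 ⟨hB.prop.1, hB⟩)

variable (C) in
lemma exists_rank_eq_card_eq_rank : ∃ B ∈ C.Δ.faces, C.r B = B.card ∧ C.r B = C.rank := by
  classical
  obtain ⟨B₀, -, hB₀⟩ := exists_isBasis_superset (indep_iff.2 ⟨C.empty_mem, C.rank_empty⟩)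
  obtain ⟨B, hB, hcard⟩ := Finset.exists_mem_eq_sup (C.Δ.faces.filter fun σ => C.IsBasis σ)
    ⟨B₀, Finset.mem_filter.2 ⟨hB₀.prop.1, hB₀⟩⟩ Finset.card
  obtain ⟨hface, hB⟩ := Finset.mem_filter.1 hB
  have h := (indep_iff.1 hB.prop).2
  refine ⟨B, hface, h, h.trans ?_⟩
  rw [rank, ← hcard]

lemma rank_eq_of_forall_le {m : ℕ} (h₁ : ∀ σ ∈ C.Δ.faces, C.r σ ≤ m)
    (h₂ : ∃ σ ∈ C.Δ.faces, C.r σ = m) : C.rank = m := by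
  obtain ⟨B, hB, -, hr⟩ := C.exists_rank_eq_card_eq_rank
  obtain ⟨σ, hσ, rfl⟩ := h₂
  exact (hr ▸ h₁ B hB).antisymm (rank_le_rank hσ)

/-- Every face is contained in a face of full rank: by the exchange property, facets have full
rank. -/
lemma exists_superset_rank_eq_rank {σ : Finset α} (hσ : σ ∈ C.Δ.faces) :
    ∃ τ ∈ C.Δ.faces, σ ⊆ τ ∧ C.r τ = C.rank := by
  obtain ⟨τ, hστ, hτ⟩ := C.Δ.faces.exists_le_maximal hσ
  refine ⟨τ, hτ.prop, hστ, (rank_le_rank hτ.prop).antisymm (not_lt.1 fun hlt => ?_)⟩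
  obtain ⟨B, hB, -, hr⟩ := C.exists_rank_eq_card_eq_rank
  obtain ⟨y, hy, hins⟩ := C.exchange τ hτ.prop B hB (hr ▸ hlt)
  exact (Finset.mem_sdiff.1 hy).2
    (hτ.le_of_ge hins (Finset.subset_insert y τ) (Finset.mem_insert_self y τ))

/-- A set of loops is a face of rank zero. -/
lemma mem_faces_and_rank_eq_zero {σ : Finset α}
    (h : ∀ x ∈ σ, {x} ∈ C.Δ.faces ∧ C.r {x} = 0) : σ ∈ C.Δ.faces ∧ C.r σ = 0 := by
  induction σ using Finset.induction_on with
  | empty => exact ⟨C.empty_mem, C.rank_empty⟩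
  | insert x σ hx ih =>
    obtain ⟨hσ, hr⟩ := ih fun y hy => h y (Finset.mem_insert_of_mem hy)
    obtain ⟨hx', hrx⟩ := h x (Finset.mem_insert_self x σ)
    have hmem : insert x σ ∈ C.Δ.faces := by
      rw [Finset.insert_eq]
      refine C.union_mem _ hx' _ hσ ?_
      rw [Finset.singleton_inter_of_notMem hx, hrx, C.rank_empty]
    have := rank_insert_le hmem
    exact ⟨hmem, by omega⟩

/-- The deletion of an element from a semimatroid. -/
def deletion (C : Semimatroid α) (x : α) : Semimatroid α where
  Δ := C.Δ.deletion x
  r := C.r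
  nonvoid := ⟨∅, FinComplex.mem_deletion.2 ⟨C.empty_mem, Finset.notMem_empty x⟩⟩
  rank_le_card σ hσ := C.rank_le_card σ (FinComplex.mem_deletion.1 hσ).1
  rank_mono σ hσ τ hτ := C.rank_mono σ (FinComplex.mem_deletion.1 hσ).1 τ
    (FinComplex.mem_deletion.1 hτ).1
  submodular σ hσ τ hτ h := C.submodular σ (FinComplex.mem_deletion.1 hσ).1 τ
    (FinComplex.mem_deletion.1 hτ).1 (FinComplex.mem_deletion.1 h).1
  union_mem σ hσ τ hτ h := by
    obtain ⟨hσ, hxσ⟩ := FinComplex.mem_deletion.1 hσ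
    obtain ⟨hτ, hxτ⟩ := FinComplex.mem_deletion.1 hτ
    exact FinComplex.mem_deletion.2 ⟨C.union_mem σ hσ τ hτ h, by simp [hxσ, hxτ]⟩
  exchange σ hσ τ hτ h := by
    obtain ⟨hσ, hxσ⟩ := FinComplex.mem_deletion.1 hσ
    obtain ⟨hτ, hxτ⟩ := FinComplex.mem_deletion.1 hτ
    obtain ⟨y, hy, hins⟩ := C.exchange σ hσ τ hτ h
    have hxy : x ≠ y := fun h => hxτ (h ▸ (Finset.mem_sdiff.1 hy).1)
    exact ⟨y, hy, FinComplex.mem_deletion.2 ⟨hins, by simp [hxσ, hxy]⟩⟩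

lemma rank_singleton_le_rank_insert {x : α} {σ : Finset α} (h : insert x σ ∈ C.Δ.faces) :
    C.r {x} ≤ C.r (insert x σ) :=
  C.rank_mono _ (singleton_mem h (Finset.mem_insert_self x σ)) _ h
    (Finset.singleton_subset_iff.2 (Finset.mem_insert_self x σ))

/-- The contraction of a vertex `x` of a semimatroid: the link of `x` with the rank function
`τ ↦ r(τ ∪ {x}) - r({x})`. The subtraction is exact on faces of the link. -/
def contraction (C : Semimatroid α) {x : α} (hx : {x} ∈ C.Δ.faces) : Semimatroid α where
  Δ := C.Δ.link x
  r τ := C.r (insert x τ) - C.r {x}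
  nonvoid := ⟨∅, FinComplex.mem_link.2 ⟨Finset.notMem_empty x, hx⟩⟩
  rank_le_card σ hσ := by
    have hσ' := (FinComplex.mem_link.1 hσ).2
    have h₁ := rank_insert_le hσ'
    have h₂ := C.rank_le_card σ (C.Δ.down_closed _ hσ' _ (Finset.subset_insert x σ))
    omega
  rank_mono σ hσ τ hτ h := Nat.sub_le_sub_right (C.rank_mono _ (FinComplex.mem_link.1 hσ).2 _
    (FinComplex.mem_link.1 hτ).2 (Finset.insert_subset_insert x h)) _
  submodular σ hσ τ hτ h := by
    have hσ' := (FinComplex.mem_link.1 hσ).2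
    have hτ' := (FinComplex.mem_link.1 hτ).2
    have h' := (FinComplex.mem_link.1 h).2
    have h₁ := rank_union_add_rank_inter_le (C := C) (σ := insert x σ) (τ := insert x τ)
      (by rwa [← Finset.insert_union_distrib])
    rw [← Finset.insert_union_distrib, ← Finset.insert_inter_distrib] at h₁
    have h₂ := rank_singleton_le_rank_insert hσ'
    have h₃ := rank_singleton_le_rank_insert hτ'
    have h₄ := rank_singleton_le_rank_insert h'
    have h₅ := rank_singleton_le_rank_insert (C := C) (σ := σ ∩ τ) (x := x) (C.Δ.down_closed _ hσ' _
      (Finset.insert_subset_insert x Finset.inter_subset_left))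
    omega
  union_mem σ hσ τ hτ h := by
    obtain ⟨hxσ, hσ'⟩ := FinComplex.mem_link.1 hσ
    obtain ⟨hxτ, hτ'⟩ := FinComplex.mem_link.1 hτ
    refine FinComplex.mem_link.2 ⟨by simp [hxσ, hxτ], ?_⟩
    rw [Finset.insert_union_distrib]
    refine C.union_mem _ hσ' _ hτ' ?_
    rw [← Finset.insert_inter_distrib]
    have h₂ := rank_singleton_le_rank_insert hσ'
    have h₃ := rank_singleton_le_rank_insert (C := C) (σ := σ ∩ τ) (x := x) (C.Δ.down_closed _ hσ' _
      (Finset.insert_subset_insert x Finset.inter_subset_left))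
    omega
  exchange σ hσ τ hτ h := by
    obtain ⟨hxσ, hσ'⟩ := FinComplex.mem_link.1 hσ
    obtain ⟨hxτ, hτ'⟩ := FinComplex.mem_link.1 hτ
    obtain ⟨y, hy, hins⟩ := C.exchange _ hσ' _ hτ' (by omega)
    simp only [Finset.mem_sdiff, Finset.mem_insert, not_or] at hy
    obtain ⟨hyτ, hyx, hyσ⟩ := hy
    refine ⟨y, Finset.mem_sdiff.2 ⟨hyτ.resolve_left hyx, hyσ⟩, FinComplex.mem_link.2 ⟨?_, ?_⟩⟩
    · simp [hxσ, Ne.symm hyx]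
    · rwa [Finset.insert_comm]

lemma rank_contraction {x : α} (hx : {x} ∈ C.Δ.faces) :
    (C.contraction hx).rank = C.rank - C.r {x} := by
  refine rank_eq_of_forall_le
    (fun σ hσ => Nat.sub_le_sub_right (rank_le_rank (FinComplex.mem_link.1 hσ).2) _) ?_
  obtain ⟨τ, hτ, hxτ, hr⟩ := exists_superset_rank_eq_rank hx
  have hins := Finset.insert_erase (Finset.singleton_subset_iff.1 hxτ)
  refine ⟨τ.erase x, FinComplex.mem_link.2 ⟨Finset.notMem_erase x τ, by rwa [hins]⟩, ?_⟩
  change C.r (insert x (τ.erase x)) - C.r {x} = _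
  rw [hins, hr]

lemma rank_deletion {x : α} (h : ∃ σ ∈ C.Δ.faces, C.r σ = C.rank ∧ x ∉ σ) :
    (C.deletion x).rank = C.rank := by
  obtain ⟨σ, hσ, hr, hx⟩ := h
  exact rank_eq_of_forall_le (fun τ hτ => rank_le_rank (FinComplex.mem_deletion.1 hτ).1)
    ⟨σ, FinComplex.mem_deletion.2 ⟨hσ, hx⟩, hr⟩

/-! ### Decision trees of semimatroids -/

/-- Construction of decision trees of semimatroids by deletion and contraction. Here `compat C f`
is a hypothesis on the function `f` on the faces of `C`, and `good C σ` is the property which the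
evasive faces are to have. At each step either the tree ends in a leaf, which has an evasive face only
if the ground set is empty, or there is an element `x` to query such that `good` lifts from the
deletion and from the contraction of `x`. -/
lemma exists_isDecisionTree {P : Type*} (compat : Semimatroid α → (Finset α → P) → Prop)
    (good : Semimatroid α → Finset α → Prop)
    (step : ∀ C f, compat C f →
      (C.Δ.ground ∈ C.Δ.faces ∧ (∀ σ ∈ C.Δ.faces, f σ = f ∅) ∧ (C.Δ.ground = ∅ → good C ∅)) ∨
      ∃ x ∈ C.Δ.ground, compat (C.deletion x) f ∧
        (∀ σ ∈ (C.Δ.deletion x).faces, good (C.deletion x) σ → good C σ) ∧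
        ∀ hx : {x} ∈ C.Δ.faces, compat (C.contraction hx) (fun τ => f (insert x τ)) ∧
          ∀ σ ∈ (C.Δ.link x).faces, good (C.contraction hx) σ → good C (insert x σ))
    (C : Semimatroid α) (f : Finset α → P) (hf : compat C f) :
    ∃ T : FTree α P, IsDecisionTree C.Δ f T ∧ ∀ σ ∈ evasiveFaces C.Δ T, good C σ := by
  induction hn : C.Δ.ground.card generalizing C f with
  | zero =>
    obtain ⟨hS, hconst, hgood⟩ | ⟨x, hx, -⟩ := step C f hf
    · have hempty := Finset.card_eq_zero.1 hn
      refine ⟨.value (f ∅), .leaf _ _ _ (fun σ h => C.Δ.down_closed _ hS _ h) hconst,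
        fun σ hσ => ?_⟩
      have := C.Δ.subset_ground σ (mem_evasiveFaces.1 hσ).1
      rw [hempty, Finset.subset_empty] at this
      exact this ▸ hgood hempty
    · rw [Finset.card_eq_zero.1 hn] at hx
      exact absurd hx (Finset.notMem_empty x)
  | succ n ih =>
    obtain ⟨hS, hconst, -⟩ | ⟨x, hx, hdel, hgood, hlink⟩ := step C f hf
    · refine ⟨.value (f ∅), .leaf _ _ _ (fun σ h => C.Δ.down_closed _ hS _ h) hconst,
        fun σ hσ => ?_⟩
      have h := (mem_evasiveFaces.1 hσ).2
      rw [hn] at h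
      exact absurd h (Nat.succ_ne_zero n).symm
    have hcard : (C.Δ.ground.erase x).card = n := by rw [Finset.card_erase_of_mem hx, hn]; rfl
    obtain ⟨no, hno, hno'⟩ := ih (C.deletion x) f hdel hcard
    have hnot : ∀ (yes : FTree α P), ∀ σ ∈ evasiveFaces C.Δ (.query x yes no), x ∉ σ →
        good C σ := fun yes σ hσ hxσ => by
      have h := (mem_evasiveFaces_query_of_notMem hx hxσ).1 hσ
      exact hgood σ (mem_evasiveFaces.1 h).1 (hno' σ h)
    by_cases hvert : {x} ∈ C.Δ.faces
    · obtain ⟨hcompat, hgood'⟩ := hlink hvert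
      obtain ⟨yes, hyes, hyes'⟩ := ih (C.contraction hvert) _ hcompat hcard
      refine ⟨.query x yes no, .vertex _ _ x yes no hx hvert hyes hno, fun σ hσ => ?_⟩
      by_cases hxσ : x ∈ σ
      · rw [← Finset.insert_erase hxσ] at hσ ⊢
        have h := (insert_mem_evasiveFaces_query hx hyes (Finset.notMem_erase x σ)).1 hσ
        exact hgood' _ (mem_evasiveFaces.1 h).1 (hyes' _ h)
      · exact hnot yes σ hσ hxσ
    · refine ⟨.query x .notFace no, .nonvertex _ _ x no hx hvert hno, fun σ hσ => ?_⟩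
      exact hnot _ σ hσ fun hxσ => hvert (singleton_mem (mem_evasiveFaces.1 hσ).1 hxσ)

lemma rank_eq_card_insert_of_contraction {x : α} (hx : {x} ∈ C.Δ.faces) (hloop : C.r {x} ≠ 0)
    {σ : Finset α} (hσ : σ ∈ (C.Δ.link x).faces) (h : (C.contraction hx).r σ = σ.card) :
    C.r (insert x σ) = (insert x σ).card := by
  change C.r (insert x σ) - C.r {x} = σ.card at h
  obtain ⟨hxσ, hσ⟩ := FinComplex.mem_link.1 hσ
  have h₁ := rank_singleton_le_rank_insert hσ
  have h₂ := rank_singleton_le_one hx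
  rw [Finset.card_insert_of_notMem hxσ]
  omega

/-- The rank function has a decision tree all of whose evasive faces are independent: query
elements that are not loops. -/
lemma exists_isDecisionTree_rank (C : Semimatroid α) :
    ∃ T : FTree α ℕ, IsDecisionTree C.Δ C.r T ∧ ∀ σ ∈ evasiveFaces C.Δ T, C.r σ = σ.card := by
  refine exists_isDecisionTree
    (fun C f => ∀ σ ∈ C.Δ.faces, ∀ τ ∈ C.Δ.faces, C.r σ = C.r τ → f σ = f τ)
    (fun C σ => C.r σ = σ.card) (fun C f hf => ?_) C C.r fun _ _ _ _ h => h
  by_cases hloops : ∀ x ∈ C.Δ.ground, {x} ∈ C.Δ.faces ∧ C.r {x} = 0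
  · obtain ⟨hS, hr⟩ := mem_faces_and_rank_eq_zero hloops
    refine .inl ⟨hS, fun σ hσ => hf σ hσ ∅ C.empty_mem ?_, fun _ => C.rank_empty⟩
    have := C.rank_mono σ hσ _ hS (C.Δ.subset_ground σ hσ)
    rw [C.rank_empty]
    omega
  · push Not at hloops
    obtain ⟨x, hx, hloop⟩ := hloops
    refine .inr ⟨x, hx, fun σ hσ τ hτ h => hf σ (FinComplex.mem_deletion.1 hσ).1 τ
      (FinComplex.mem_deletion.1 hτ).1 h, fun σ _ h => h, fun hvert => ⟨fun σ hσ τ hτ h => ?_,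
      fun σ hσ h => rank_eq_card_insert_of_contraction hvert (hloop hvert) hσ h⟩⟩
    change C.r (insert x σ) - C.r {x} = C.r (insert x τ) - C.r {x} at h
    have hσ' := (FinComplex.mem_link.1 hσ).2
    have hτ' := (FinComplex.mem_link.1 hτ).2
    have h₁ := rank_singleton_le_rank_insert hσ'
    have h₂ := rank_singleton_le_rank_insert hτ'
    exact hf _ hσ' _ hτ' (by omega)

/-- The nullity function has a decision tree all of whose evasive faces have full rank: query
elements that are not contained in all faces of full rank. -/
lemma exists_isDecisionTree_nullity (C : Semimatroid α) :
    ∃ T : FTree α ℕ, IsDecisionTree C.Δ C.nullity T ∧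
      ∀ σ ∈ evasiveFaces C.Δ T, C.r σ = C.rank := by
  refine exists_isDecisionTree
    (fun C f => ∀ σ ∈ C.Δ.faces, ∀ τ ∈ C.Δ.faces, C.nullity σ = C.nullity τ → f σ = f τ)
    (fun C σ => C.r σ = C.rank) (fun C f hf => ?_) C C.nullity fun _ _ _ _ h => h
  by_cases hcoloops : ∀ x ∈ C.Δ.ground, ∀ σ ∈ C.Δ.faces, C.r σ = C.rank → x ∈ σ
  · obtain ⟨B, hB, hind, hr⟩ := C.exists_rank_eq_card_eq_rank
    have hBS : B = C.Δ.ground :=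
      (C.Δ.subset_ground B hB).antisymm fun x hx => hcoloops x hx B hB hr
    refine .inl ⟨hBS ▸ hB, fun σ hσ => hf σ hσ ∅ C.empty_mem ?_, fun h => ?_⟩
    · have h := rank_eq_card_of_subset hB hind (hBS ▸ C.Δ.subset_ground σ hσ)
      rw [nullity, nullity, h, C.rank_empty]
      simp
    · rw [← hr, hBS, h]
  · push Not at hcoloops
    obtain ⟨x, hx, hcoloop⟩ := hcoloops
    refine .inr ⟨x, hx, fun σ hσ τ hτ h => hf σ (FinComplex.mem_deletion.1 hσ).1 τ
      (FinComplex.mem_deletion.1 hτ).1 h, fun σ _ h => h.trans (rank_deletion hcoloop),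
      fun hvert => ⟨fun σ hσ τ hτ h => ?_, fun σ hσ h => ?_⟩⟩
    · have hcardσ := (C.contraction hvert).rank_le_card σ hσ
      have hcardτ := (C.contraction hvert).rank_le_card τ hτ
      simp only [nullity, contraction] at h hcardσ hcardτ
      obtain ⟨hxσ, hσ'⟩ := FinComplex.mem_link.1 hσ
      obtain ⟨hxτ, hτ'⟩ := FinComplex.mem_link.1 hτ
      have h₁ := rank_singleton_le_rank_insert hσ'
      have h₂ := rank_singleton_le_rank_insert hτ'
      have h₃ := rank_singleton_le_one hvert
      refine hf _ hσ' _ hτ' ?_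
      rw [nullity, nullity, Finset.card_insert_of_notMem hxσ, Finset.card_insert_of_notMem hxτ]
      omega
    · rw [rank_contraction] at h
      change C.r (insert x σ) - C.r {x} = _ at h
      have h₁ := rank_singleton_le_rank_insert (FinComplex.mem_link.1 hσ).2
      have h₂ := rank_le_rank hvert
      omega

/-- A constant function has a decision tree all of whose evasive faces have the cardinality of a
basis: query elements that are neither loops nor contained in all faces of full rank. -/
lemma exists_isDecisionTree_const (C : Semimatroid α) :
    ∃ T : FTree α Unit, IsDecisionTree C.Δ (fun _ => ()) T ∧
      ∀ σ ∈ evasiveFaces C.Δ T, σ.card = C.rank := by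
  refine exists_isDecisionTree (fun _ _ => True) (fun C σ => σ.card = C.rank)
    (fun C f _ => ?_) C _ trivial
  by_cases hall : ∀ x ∈ C.Δ.ground, ({x} ∈ C.Δ.faces ∧ C.r {x} = 0) ∨
      ∀ σ ∈ C.Δ.faces, C.r σ = C.rank → x ∈ σ
  · -- The loops together with the unique basis form a face.
    obtain ⟨B, hB, hind, hr⟩ := C.exists_rank_eq_card_eq_rank
    obtain ⟨hL, hrL⟩ := mem_faces_and_rank_eq_zero
      (σ := C.Δ.ground.filter fun x => {x} ∈ C.Δ.faces ∧ C.r {x} = 0)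
      fun x hx => (Finset.mem_filter.1 hx).2
    have hLB := C.union_mem _ hL B hB (by
      have := C.rank_mono _ (C.Δ.down_closed _ hL _ Finset.inter_subset_left) _ hL
        (Finset.inter_subset_left (s₂ := B))
      omega)
    refine .inl ⟨C.Δ.down_closed _ hLB _ fun x hx => ?_, fun _ _ => rfl, fun h => ?_⟩
    · rcases hall x hx with h | h
      · exact Finset.mem_union_left _ (Finset.mem_filter.2 ⟨hx, h⟩)
      · exact Finset.mem_union_right _ (h B hB hr)
    · have := C.Δ.subset_ground B hB
      rw [h, Finset.subset_empty] at this
      rw [← hr, this, C.rank_empty, Finset.card_empty]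
  · push Not at hall
    obtain ⟨x, hx, hloop, hcoloop⟩ := hall
    refine .inr ⟨x, hx, trivial, fun σ _ h => h.trans (rank_deletion hcoloop),
      fun hvert => ⟨trivial, fun σ hσ h => ?_⟩⟩
    have h₀ := hloop hvert
    have h₁ := rank_singleton_le_one hvert
    have h₂ := rank_le_rank hvert
    rw [rank_contraction] at h
    rw [Finset.card_insert_of_notMem (FinComplex.mem_link.1 hσ).1]
    omega

end Semimatroid

/-! ### Poincaré polynomials and the Tutte polynomial -/

section Poincare

variable {α : Type*}

lemma evasiveCount_eq_card_filter [DecidableEq α] {P : Type*} [DecidableEq P] (Δ : FinComplex α)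
    (f : Finset α → P) (T : FTree α P) (p : P) (i : ℕ) :
    evasiveCount Δ f T p i =
      ((evasiveFaces Δ T).filter fun σ => (σ.card, f σ) = (i, p)).card := by
  classical
  rw [evasiveCount]
  congr 1
  ext σ
  simp only [Finset.mem_filter, mem_evasiveFaces, Prod.mk.injEq]
  tauto

/-- A sum over all values of a map on a finite set, weighted by the sizes of the fibers. -/
lemma finsum_card_fiber_mul {ι κ R : Type*} [CommRing R] [DecidableEq κ] (E : Finset ι)
    (g : ι → κ) (w : κ → R) :
    ∑ᶠ a, ((E.filter fun σ => g σ = a).card : R) * w a = ∑ σ ∈ E, w (g σ) := by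
  classical
  rw [finsum_eq_sum_of_support_subset (s := E.image g), Finset.sum_comp w g]
  · exact Finset.sum_congr rfl fun a _ => (nsmul_eq_mul _ _).symm
  · intro a ha
    by_contra h
    refine ha ?_
    have : (E.filter fun σ => g σ = a) = ∅ := Finset.filter_false_of_mem fun σ hσ hg =>
      h (Finset.mem_coe.2 (hg ▸ Finset.mem_image_of_mem g hσ))
    change ((E.filter fun σ => g σ = a).card : R) * w a = 0
    rw [this, Finset.card_empty, Nat.cast_zero, zero_mul]

lemma neg_one_pow_mul_neg_one_pow_self {R : Type*} [CommRing R] (n : ℕ) :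
    (-1 : R) ^ n * (-1) ^ n = 1 := by
  rw [← mul_pow]
  simp

lemma pow_add_mul_add_one_div_sub_one_pow {F : Type*} [Field F] {z : F} (hz : z ≠ 0) (m e : ℕ)
    (b : F) : z ^ (m + e) * (((z + 1) / z - 1) ^ e * b) = z ^ m * b := by
  have h : (z + 1) / z - 1 = z⁻¹ := by
    rw [add_div, div_self hz, add_sub_cancel_left, one_div]
  rw [h, inv_pow, pow_add, mul_assoc, mul_inv_cancel_left₀ (pow_ne_zero e hz)]

variable [LinearOrder α] {k : Type*} [Field k] {Δ : FinComplex α}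

/-- If the cardinality of an evasive face is determined by the value of `f`, then the Poincaré
polynomial is a signed sum over all faces. -/
lemma poincarePoly_eq_sum_faces {f : Finset α → ℕ} {T : FTree α ℕ} (hT : IsDecisionTree Δ f T)
    (hf : Δ.MonotoneFun f) (d : ℕ → ℕ) (hd : ∀ σ ∈ evasiveFaces Δ T, σ.card = d (f σ)) :
    poincarePoly k Δ f = ∑ σ ∈ Δ.faces,
      (-1) ^ σ.card * ((-1) ^ d (f σ) * MvPolynomial.X 0 ^ d (f σ) * MvPolynomial.X 1 ^ f σ) := by
  rw [← hT.sum_evasiveFaces fun j =>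
    (-1) ^ d j * MvPolynomial.X 0 ^ d j * MvPolynomial.X 1 ^ j]
  calc poincarePoly k Δ f
      = ∑ᶠ ij : ℕ × ℕ,
          (((evasiveFaces Δ T).filter fun σ => (σ.card, f σ) = ij).card :
            MvPolynomial (Fin 2) ℤ) * (MvPolynomial.X 0 ^ ij.1 * MvPolynomial.X 1 ^ ij.2) := by
        refine finsum_congr fun ij => ?_
        rw [← (hT.isOptimalTree hf d hd).2, evasiveCount_eq_card_filter, mul_assoc]
        simp
    _ = ∑ σ ∈ evasiveFaces Δ T, MvPolynomial.X 0 ^ σ.card * MvPolynomial.X 1 ^ f σ :=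
        finsum_card_fiber_mul (evasiveFaces Δ T) (fun σ => (σ.card, f σ))
          fun ij => MvPolynomial.X 0 ^ ij.1 * MvPolynomial.X 1 ^ ij.2
    _ = _ := by
        refine Finset.sum_congr rfl fun σ hσ => ?_
        rw [← hd σ hσ, ← mul_assoc, ← mul_assoc, neg_one_pow_mul_neg_one_pow_self, one_mul]

lemma complexPoincarePoly_eq_sum_faces {T : FTree α Unit}
    (hT : IsDecisionTree Δ (fun _ => ()) T) {d : ℕ} (hd : ∀ σ ∈ evasiveFaces Δ T, σ.card = d) :
    complexPoincarePoly k Δ =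
      ∑ σ ∈ Δ.faces, (-1) ^ σ.card * ((-1) ^ d * (Polynomial.X : Polynomial ℤ) ^ d) := by
  rw [← hT.sum_evasiveFaces fun _ => (-1) ^ d * (Polynomial.X : Polynomial ℤ) ^ d]
  have hsub : Δ.sublevel (fun _ => ()) () = {σ | σ ∈ Δ.faces} := by
    simp [FinComplex.sublevel]
  have hstrict : Δ.strictSublevel (fun _ => ()) () = ∅ := by
    simp [FinComplex.strictSublevel]
  calc complexPoincarePoly k Δ
      = ∑ᶠ i : ℕ, (((evasiveFaces Δ T).filter fun σ => σ.card = i).card : Polynomial ℤ) *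
          Polynomial.X ^ i := by
        refine finsum_congr fun i => ?_
        rw [← hsub, ← hstrict, ← (hT.isOptimalTree (fun _ _ _ _ _ => le_rfl) (fun _ => d) hd).2,
          evasiveCount_eq_card_filter]
        simp
    _ = ∑ σ ∈ evasiveFaces Δ T, Polynomial.X ^ σ.card :=
        finsum_card_fiber_mul (evasiveFaces Δ T) Finset.card fun i => Polynomial.X ^ i
    _ = _ := by
        refine Finset.sum_congr rfl fun σ hσ => ?_
        rw [hd σ hσ, ← mul_assoc, neg_one_pow_mul_neg_one_pow_self, one_mul]

end Poincare

namespace Semimatroid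

lemma tutteAt_eq {α : Type*} [DecidableEq α] (C : Semimatroid α) {R : Type*} [CommRing R]
    (a b : R) : C.tutteAt a b =
      ∑ σ ∈ C.Δ.faces, (a - 1) ^ (C.rank - C.r σ) * (b - 1) ^ (σ.card - C.r σ) := by
  simp [tutteAt, tutte]

lemma monotoneFun_nullity {α : Type*} [DecidableEq α] (C : Semimatroid α) :
    C.Δ.MonotoneFun C.nullity := by
  intro σ hσ τ hτ h
  have h₁ := rank_union_le (C := C) (σ := σ) (τ := τ \ σ)
    (by rwa [Finset.union_sdiff_of_subset h])
  rw [Finset.union_sdiff_of_subset h] at h₁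
  have h₂ := C.rank_le_card _ (C.Δ.down_closed _ hτ _ (Finset.sdiff_subset (t := σ)))
  have h₃ := C.rank_le_card _ hσ
  have h₄ := Finset.card_sdiff_add_card_eq_card h
  rw [nullity, nullity]
  omega

end Semimatroid

theorem theorem3p2 {α : Type*} [LinearOrder α] (k : Type*) [Field k]
    (C : Semimatroid α) (hS : C.Δ.ground.Nonempty) :
    -- the rank function; the identity is one of rational functions in `q`, `x`
    (HomologyDecidable k C.Δ C.r ∧
      (let F := FractionRing (MvPolynomial (Fin 2) ℤ)
       let q : F := algebraMap (MvPolynomial (Fin 2) ℤ) F (MvPolynomial.X 0)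
       let x : F := algebraMap (MvPolynomial (Fin 2) ℤ) F (MvPolynomial.X 1)
       algebraMap (MvPolynomial (Fin 2) ℤ) F (poincarePoly k C.Δ C.r) =
         (q * x) ^ C.rank * C.tutteAt ((q * x + 1) / (q * x)) 0)) ∧
    -- the nullity function
    (C.Δ.MonotoneFun C.nullity ∧ HomologyDecidable k C.Δ C.nullity ∧
      (let q : MvPolynomial (Fin 2) ℤ := MvPolynomial.X 0
       let x : MvPolynomial (Fin 2) ℤ := MvPolynomial.X 1
       poincarePoly k C.Δ C.nullity = q ^ C.rank * C.tutteAt 0 (q * x + 1))) ∧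
    -- the complex itself
    (SemiNonevasive k C.Δ ∧
      complexPoincarePoly k C.Δ =
        Polynomial.C (C.tutteAt (0 : ℤ) 0) * Polynomial.X ^ C.rank) := by
  refine ⟨?_, ?_, ?_⟩
  · obtain ⟨T, hT, hev⟩ := C.exists_isDecisionTree_rank
    have hmono : C.Δ.MonotoneFun C.r := C.rank_mono
    have hd : ∀ σ ∈ evasiveFaces C.Δ T, σ.card = id (C.r σ) := fun σ hσ => (hev σ hσ).symm
    refine ⟨⟨hmono, T, hT.isOptimalTree hmono id hd⟩, ?_⟩
    intro F q x
    have hX : ∀ i : Fin 2, algebraMap (MvPolynomial (Fin 2) ℤ) F (MvPolynomial.X i) ≠ 0 := fun i =>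
      (map_ne_zero_iff _ (IsFractionRing.injective _ F)).2 (MvPolynomial.X_ne_zero i)
    have hqx : q * x ≠ 0 := mul_ne_zero (hX 0) (hX 1)
    rw [poincarePoly_eq_sum_faces hT hmono id hd, Semimatroid.tutteAt_eq, map_sum, Finset.mul_sum]
    refine Finset.sum_congr rfl fun σ hσ => ?_
    obtain ⟨m, hm⟩ := Nat.exists_eq_add_of_le (C.rank_le_card σ hσ)
    obtain ⟨e, he⟩ := Nat.exists_eq_add_of_le (Semimatroid.rank_le_rank hσ)
    rw [hm, he, Nat.add_sub_cancel_left, Nat.add_sub_cancel_left, zero_sub,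
      pow_add_mul_add_one_div_sub_one_pow hqx, pow_add]
    simp only [id, map_mul, map_pow, map_neg, map_one]
    change _ * _ * (_ * q ^ _ * x ^ _) = _
    linear_combination (-1 : F) ^ m * q ^ C.r σ * x ^ C.r σ *
      neg_one_pow_mul_neg_one_pow_self (R := F) (C.r σ)
  · obtain ⟨T, hT, hev⟩ := C.exists_isDecisionTree_nullity
    have hmono := C.monotoneFun_nullity
    have hd : ∀ σ ∈ evasiveFaces C.Δ T, σ.card = C.rank + C.nullity σ := fun σ hσ => by
      rw [← hev σ hσ, Semimatroid.nullity,
        Nat.add_sub_of_le (C.rank_le_card σ (mem_evasiveFaces.1 hσ).1)]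
    refine ⟨hmono, ⟨hmono, T, hT.isOptimalTree hmono (C.rank + ·) hd⟩, ?_⟩
    intro q x
    rw [poincarePoly_eq_sum_faces hT hmono (C.rank + ·) hd, Semimatroid.tutteAt_eq, Finset.mul_sum]
    refine Finset.sum_congr rfl fun σ hσ => ?_
    obtain ⟨m, hm⟩ := Nat.exists_eq_add_of_le (C.rank_le_card σ hσ)
    obtain ⟨e, he⟩ := Nat.exists_eq_add_of_le (Semimatroid.rank_le_rank hσ)
    rw [Semimatroid.nullity, hm, he, Nat.add_sub_cancel_left, Nat.add_sub_cancel_left, zero_sub,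
      add_sub_cancel_right]
    change _ * (_ * q ^ _ * x ^ _) = _
    have h₁ := neg_one_pow_mul_neg_one_pow_self (R := MvPolynomial (Fin 2) ℤ) (C.r σ)
    have h₂ := neg_one_pow_mul_neg_one_pow_self (R := MvPolynomial (Fin 2) ℤ) m
    have hsign : (-1 : MvPolynomial (Fin 2) ℤ) ^ (C.r σ + m) * (-1) ^ (C.r σ + e + m) =
        (-1) ^ e := by
      rw [pow_add, pow_add, pow_add]
      linear_combination (-1) ^ e * ((-1) ^ m * (-1) ^ m * h₁ + h₂)
    rw [← hsign]
    ring
  · obtain ⟨T, hT, hd⟩ := C.exists_isDecisionTree_const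
    have hmono : C.Δ.MonotoneFun fun _ => () := fun _ _ _ _ _ => le_rfl
    refine ⟨⟨hmono, T, hT.isOptimalTree hmono (fun _ => C.rank) hd⟩, ?_⟩
    rw [complexPoincarePoly_eq_sum_faces hT hd, Semimatroid.tutteAt_eq, map_sum, Finset.sum_mul]
    refine Finset.sum_congr rfl fun σ hσ => ?_
    obtain ⟨m, hm⟩ := Nat.exists_eq_add_of_le (C.rank_le_card σ hσ)
    obtain ⟨e, he⟩ := Nat.exists_eq_add_of_le (Semimatroid.rank_le_rank hσ)
    rw [hm, he, Nat.add_sub_cancel_left, Nat.add_sub_cancel_left, zero_sub, pow_add, pow_add]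
    simp only [map_mul, map_pow, map_neg, map_one]
    linear_combination (-1) ^ m * (-1) ^ e * Polynomial.X ^ (C.r σ + e) *
      neg_one_pow_mul_neg_one_pow_self (R := Polynomial ℤ) (C.r σ)
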